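/- Let $(X,d)$ be a compact metric space with a finite Borel measure $\mu$; write $B(x,r)$ for open balls and $|B|=\mu(B)$. Let $\mathcal L$ be a non-negative self-adjoint operator in the real space $L_2(X,\mu)$ with domain $\mathcal D(\mathcal L)$, put $\mathcal D^\infty(\mathcal L)=\bigcap_{k}\mathcal D(\mathcal L^k)$, and assume the following. (A) There is $D>0$ with $0<|B(x,2r)|\le 2^D|B(x,r)|$ for all $x\in X$, $r>0$. (B) $\mathcal D^\infty(\mathcal L)$ is a (not necessarily unital) subalgebra of $C(X)$. For $f,g\in\mathcal D^\infty(\mathcal L)$ put $\Gamma(f,g)=\tfrac12\big(f\mathcal Lg+g\mathcal Lf-\mathcal L(fg)\big)$. (C) There is $c_0>0$ with $\int_X\Gamma(f,f)\,d\mu\le c_0\|\mathcal L^{1/2}f\|^2=c_0\langle\mathcal Lf,f\rangle$ for all $f\in\mathcal D^\infty(\mathcal L)$. (D) There are $C,\rho_0>0$ such that for all $f\in\mathcal D^\infty(\mathcal L)$, $x\in X$ and $0<\rho<\rho_0$, with $B=B(x,\rho)$ and $f_B=|B|^{-1}\int_B f\,d\mu$, $$\int_{B}|f-f_B|^2\,d\mu\le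 C\rho^2\int_{B}\Gamma(f,f)\,d\mu .$$ (E) The heat semigroup $e^{-t\mathcal L}$ has a measurable kernel, $e^{-t\mathcal L}f(x)=\int_X P_t(x,y)f(y)\,d\mu(y)$ for $t>0$, $f\in L_2(X,\mu)$ and almost every $x$, and there are $C_1,C_2,c_1,c_2>0$ such that for all $x,y\in X$ and $0<t<1$ $$\frac{C_1e^{-c_1 d(x,y)^2/t}}{\sqrt{|B(x,\sqrt t)|\,|B(y,\sqrt t)|}}\le P_t(x,y)\le\frac{C_2e^{-c_2 d(x,y)^2/t}}{\sqrt{|B(x,\sqrt t)|\,|B(y,\sqrt t)|}} .$$ For $\rho>0$ and $N\in\mathbb N$, a $(\rho,N)$-lattice is a set $\mathcal X_\rho\subseteq X$ such that the balls $B(x,\rho/2)$, $x\in\mathcal X_\rho$, are pairwise disjoint and the balls $B(x,\rho)$, $x\in\mathcal X_\rho$, cover $X$, each point of $X$ lying in at most $N$ of them. Let $\mathcal N_\omega(\mathcal L)$ be the number of eigenvalues of $\mathcal L$, counted with multiplicities, that are not greater than $\omega$. Then there is $N\in\mathbb N$ such that $(\rho,N)$-lattices exist for all sufficiently small $\rho>0$,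 and there are constants $c,\gamma\in(0,1)$ such that for all sufficiently large $\omega$ and every $N\in\mathbb N$ $$c\,\sup\operatorname{card}(\mathcal X_{\omega^{-1/2}})\le\mathcal N_\omega(\mathcal L)\le\inf\operatorname{card}(\mathcal X_{\gamma\omega^{-1/2}}),$$ where $\sup$ and $\inf$ are taken over all $(\omega^{-1/2},N)$-lattices and all $(\gamma\omega^{-1/2},N)$-lattices respectively ($\sup\emptyset=0$, $\inf\emptyset=\infty$). -/

import Mathlib

open Set Filter Topology MeasureTheory
open scoped ENNReal

noncomputable section

namespace WeakWeyl

/-- The eigenspace `{f ∈ D(L) | L f = l f}` of an unbounded operator `L`. -/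
def eigenspace {E : Type*} [AddCommGroup E] [Module ℝ E] (L : E →ₗ.[ℝ] E) (l : ℝ) :
    Submodule ℝ E :=
  (LinearMap.ker (L.toFun - l • L.domain.subtype)).map L.domain.subtype

/-- `𝒩_ω(L)`: the number of eigenvalues of `L` not greater than `ω`, each counted with its
multiplicity `dim ker (L - l)` (possibly infinite). -/
def eigenvalueCount {E : Type*} [AddCommGroup E] [Module ℝ E] (L : E →ₗ.[ℝ] E) (ω : ℝ) : ℝ≥0∞ :=
  ∑' l : Set.Iic ω, ((Cardinal.toENat (Module.rank ℝ (eigenspace L (l : ℝ))) : ℕ∞) : ℝ≥0∞)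

/-- The domain `D(L^k)` of the `k`-th power of an unbounded operator `L`. -/
def powDomain {E : Type*} [AddCommGroup E] [Module ℝ E] (L : E →ₗ.[ℝ] E) : ℕ → Set E
  | 0 => Set.univ
  | k + 1 => {f | ∃ h : f ∈ L.domain, L ⟨f, h⟩ ∈ powDomain L k}

/-- `D^∞(L) = ⋂ₖ D(L^k)`. -/
def smoothDomain {E : Type*} [AddCommGroup E] [Module ℝ E] (L : E →ₗ.[ℝ] E) : Set E :=
  ⋂ k : ℕ, powDomain L k

/-- `T t = e^{-tL}`, `t ≥ 0`: the strongly continuous semigroup whose orbits solve the heat equation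
`u' = -L u` on `(0, ∞)`. For a non-negative self-adjoint `L` these conditions determine `T t`
for all `t ≥ 0`. -/
structure IsHeatSemigroup {E : Type*} [NormedAddCommGroup E] [NormedSpace ℝ E]
    (L : E →ₗ.[ℝ] E) (T : ℝ → E →L[ℝ] E) : Prop where
  map_zero : T 0 = ContinuousLinearMap.id ℝ E
  map_add : ∀ s t : ℝ, 0 ≤ s → 0 ≤ t → T (s + t) = (T s).comp (T t)
  continuousOn : ∀ f : E, ContinuousOn (fun t => T t f) (Set.Ici 0)
  heatEquation : ∀ f : E, ∀ t : ℝ, 0 < t →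
    ∃ h : T t f ∈ L.domain, HasDerivAt (fun s => T s f) (-(L ⟨T t f, h⟩)) t

variable {X : Type*} [MetricSpace X] [CompactSpace X] [MeasurableSpace X] [BorelSpace X]

/-- The doubling condition `0 < |B(x,2r)| ≤ 2^D |B(x,r)|` for all balls. -/
def IsDoubling (μ : Measure X) : Prop :=
  ∃ D : ℝ, 0 < D ∧ ∀ (x : X) (r : ℝ), 0 < r →
    0 < μ.real (Metric.ball x (2 * r)) ∧
      μ.real (Metric.ball x (2 * r)) ≤ (2 : ℝ) ^ D * μ.real (Metric.ball x r)

section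

variable (μ : Measure X) [IsFiniteMeasure μ]

/-- The class in `L₂(X, μ)` of a continuous function. -/
abbrev toL2 (f : C(X, ℝ)) : Lp ℝ 2 μ := ContinuousMap.toLp (E := ℝ) 2 μ ℝ f

variable {μ} (L : Lp ℝ 2 μ →ₗ.[ℝ] Lp ℝ 2 μ)

open Classical in
/-- `L f` for a continuous function `f` (with the value `0` when `f ∉ D(L)`). -/
def applyOp (f : C(X, ℝ)) : Lp ℝ 2 μ :=
  if h : toL2 μ f ∈ L.domain then L ⟨toL2 μ f, h⟩ else 0

/-- `D^∞(L)` consists of (the classes of) the functions of a subalgebra of `C(X)`;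
the subalgebra is not required to contain the constants. -/
def SmoothDomainIsSubalgebra : Prop :=
  ∃ A : NonUnitalSubalgebra ℝ C(X, ℝ), (toL2 μ) '' (A : Set C(X, ℝ)) = smoothDomain L

/-- The squared gradient `Γ(f,f)`, where `Γ(f,g) = (f L g + g L f - L (f g)) / 2`, for continuous
`f, g` with classes in `D^∞(L)`. The sign is the one that makes `Γ(f,f) = |∇f|²` for the
non-negative operator `L = -Δ`. -/
def Gam (f g : C(X, ℝ)) (x : X) : ℝ :=
  (1 / 2) * (f x * applyOp L g x + g x * applyOp L f x - applyOp L (f * g) x)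

/-- `∫ Γ(f,f) dμ ≤ c ‖L^{1/2} f‖²` on `D^∞(L)`, with `‖L^{1/2} f‖² = ⟨L f, f⟩` for `f ∈ D(L)`. -/
def GradientBound : Prop :=
  ∃ c : ℝ, 0 < c ∧ ∀ f : C(X, ℝ), toL2 μ f ∈ smoothDomain L →
    ∫ x, Gam L f f x ∂μ ≤ c * inner ℝ (applyOp L f) (toL2 μ f)

/-- The local Poincaré inequality on all balls of sufficiently small radius, for `f ∈ D^∞(L)`. -/
def LocalPoincare : Prop :=
  ∃ C ρ₀ : ℝ, 0 < C ∧ 0 < ρ₀ ∧ ∀ f : C(X, ℝ), toL2 μ f ∈ smoothDomain L →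
    ∀ (x : X) (ρ : ℝ), 0 < ρ → ρ < ρ₀ →
      ∫ y in Metric.ball x ρ, (f y - ⨍ z in Metric.ball x ρ, f z ∂μ) ^ 2 ∂μ ≤
        C * ρ ^ 2 * ∫ y in Metric.ball x ρ, Gam L f f y ∂μ

/-- `P t x y` (`t > 0`) is the heat kernel of `L`:
`(e^{-tL} f)(x) = ∫ P t x y f(y) dμ(y)` for almost every `x`. -/
def IsHeatKernel (P : ℝ → X → X → ℝ) : Prop :=
  ∃ T : ℝ → Lp ℝ 2 μ →L[ℝ] Lp ℝ 2 μ, IsHeatSemigroup L T ∧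
    ∀ t : ℝ, 0 < t → Measurable (Function.uncurry (P t)) ∧
      ∀ f : Lp ℝ 2 μ,
        (∀ᵐ x ∂μ, Integrable (fun y => P t x y * f y) μ) ∧
        (T t f : X → ℝ) =ᵐ[μ] fun x => ∫ y, P t x y * f y ∂μ

/-- The heat kernel of `L` satisfies the two-sided short-time Gaussian estimates. -/
def HasGaussianHeatKernel : Prop :=
  ∃ P : ℝ → X → X → ℝ, IsHeatKernel L P ∧
    ∃ C₁ C₂ c₁ c₂ : ℝ, 0 < C₁ ∧ 0 < C₂ ∧ 0 < c₁ ∧ 0 < c₂ ∧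
      ∀ (t : ℝ) (x y : X), 0 < t → t < 1 →
        C₁ * Real.exp (-c₁ * dist x y ^ 2 / t) /
            √(μ.real (Metric.ball x √t) * μ.real (Metric.ball y √t)) ≤ P t x y ∧
        P t x y ≤ C₂ * Real.exp (-c₂ * dist x y ^ 2 / t) /
            √(μ.real (Metric.ball x √t) * μ.real (Metric.ball y √t))

end

/-- A metric `(ρ, N)`-lattice: a set of points such that the balls of radius `ρ/2` about them
are disjoint and the balls of radius `ρ` cover the space with multiplicity at most `N`. -/
structure IsLattice {X : Type*} [MetricSpace X] (ρ : ℝ) (N : ℕ) (S : Set X) : Prop where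
  disjoint : S.PairwiseDisjoint fun x => Metric.ball x (ρ / 2)
  cover : ⋃ x ∈ S, Metric.ball x ρ = Set.univ
  multiplicity : ∀ y : X, {x ∈ S | y ∈ Metric.ball x ρ}.encard ≤ N

end WeakWeyl

end

/-! Write `E_ω` for `lowSpan L ω`, the span of the eigenvectors with eigenvalue at most `ω`.
Eigenspaces are mutually orthogonal, so counting eigenvalues amounts to computing `dim E_ω`.

Upper bound: if `f ∈ E_ω` has mean zero on every ball of a `ρ`-lattice, summing the local Poincaré
inequality over the lattice and using the gradient bound gives `‖f‖² ≤ K ρ² ⟨L f, f⟩ ≤ K ρ² ω ‖f‖²`.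
For `ρ = γ ω^{-1/2}` with `K γ² < 1` this forces `f = 0`. The ball averages are therefore injective
on `E_ω`, and `dim E_ω` is at most the number of balls (`exists_norm_sq_le_of_setIntegral_eq_zero`,
`exists_eigenvalueCount_le`).

Lower bound: the normalized indicators `u` of the disjoint balls of radius `ρ/2`, `ρ = ω^{-1/2}`,
are orthonormal. Splitting `u = p + q` along `E_ω` and its complement, where the semigroup decays
like `e^{-ωs}`, gives `⟨T(4s)u, u⟩ ≤ ‖p‖² + e^{-2ωs} ⟨T(2s)u, u⟩`. For `s` a large fixed multiple of
`1/ω`, the Gaussian bounds keep `‖p‖²` above a constant, and the sum of the `‖p‖²` is at most the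
trace of the projection, `dim E_ω` (`IsHeatSemigroup.card_mul_le_finrank`,
`exists_mul_encard_le_eigenvalueCount`).

The spectral theorem for unbounded operators is avoided: the decay off `E_ω` comes from compactness
of `T s`, whose kernel is bounded. -/

namespace WeakWeyl

/-! ### Heat semigroups of symmetric operators and their decay off the low eigenspaces -/

section Hilbert

variable {E : Type*} [NormedAddCommGroup E] [InnerProductSpace ℝ E] {L : E →ₗ.[ℝ] E}

open scoped InnerProductSpace

theorem mem_eigenspace {l : ℝ} {f : E} :
    f ∈ eigenspace L l ↔ ∃ h : f ∈ L.domain, L ⟨f, h⟩ = l • f := by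
  constructor
  · rintro ⟨x, hx, rfl⟩
    refine ⟨x.2, ?_⟩
    have : L.toFun x - l • (x : E) = 0 := hx
    exact sub_eq_zero.mp this
  · rintro ⟨h, hf⟩
    refine ⟨⟨f, h⟩, ?_, rfl⟩
    change L.toFun ⟨f, h⟩ - l • f = 0
    exact sub_eq_zero.mpr hf

/-- The span of the eigenvectors with eigenvalues at most `ω`. -/
def lowSpan (L : E →ₗ.[ℝ] E) (ω : ℝ) : Submodule ℝ E := ⨆ l : Set.Iic ω, eigenspace L (l : ℝ)

theorem mem_lowSpan_orthogonal {ω : ℝ} {g : E} :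
    g ∈ (lowSpan L ω)ᗮ ↔ ∀ l ≤ ω, ∀ e ∈ eigenspace L l, ⟪e, g⟫_ℝ = 0 := by
  rw [lowSpan, ← Submodule.iInf_orthogonal]
  simp [Submodule.mem_iInf, Submodule.mem_orthogonal]

theorem symmetric_of_isSelfAdjoint [CompleteSpace E] (hL : IsSelfAdjoint L) (x y : L.domain) :
    ⟪L x, (y : E)⟫_ℝ = ⟪(x : E), L y⟫_ℝ := by
  have h := LinearPMap.adjoint_isFormalAdjoint hL.dense_domain
  rw [LinearPMap.isSelfAdjoint_def.mp hL] at h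
  exact h x y

variable {T : ℝ → E →L[ℝ] E}

/-- By symmetry of `L`, `s ↦ ⟪T s f, T (t - s) g⟫` has zero derivative on `(0, t)`; compare its
endpoints. -/
theorem IsHeatSemigroup.inner_comm (hT : IsHeatSemigroup L T)
    (hL : ∀ x y : L.domain, ⟪L x, (y : E)⟫_ℝ = ⟪(x : E), L y⟫_ℝ) {t : ℝ} (ht : 0 ≤ t) (f g : E) :
    ⟪T t f, g⟫_ℝ = ⟪f, T t g⟫_ℝ := by
  rcases ht.eq_or_lt with rfl | ht
  · simp [hT.map_zero]
  choose h hd using fun s : Ioi (0 : ℝ) => hT.heatEquation f s s.2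
  choose h' hd' using fun s : Ioi (0 : ℝ) => hT.heatEquation g s s.2
  obtain ⟨c, -, hc⟩ := exists_hasDerivAt_eq_slope (fun s => ⟪T s f, T (t - s) g⟫_ℝ) (fun _ => 0) ht
    (((hT.continuousOn f).mono Icc_subset_Ici_self).inner
      ((hT.continuousOn g).comp (by fun_prop) fun s hs => by simpa using hs.2))
    (fun s hs => by
      have h1 := hd ⟨s, hs.1⟩
      have h2 := (hd' ⟨t - s, sub_pos.mpr hs.2⟩).scomp s ((hasDerivAt_id s).const_sub t)
      have h3 := h1.inner ℝ h2
      refine h3.congr_deriv ?_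
      have := hL ⟨_, h ⟨s, hs.1⟩⟩ ⟨_, h' ⟨t - s, sub_pos.mpr hs.2⟩⟩
      simp only [Function.comp, id_eq, inner_smul_right, inner_neg_right, inner_neg_left] at this ⊢
      linarith)
  rw [eq_comm, div_eq_zero_iff] at hc
  rcases hc with hc | hc
  · simp [hT.map_zero] at hc
    linarith
  · linarith

theorem IsHeatSemigroup.norm_le (hT : IsHeatSemigroup L T)
    (hL : ∀ x : L.domain, 0 ≤ ⟪L x, (x : E)⟫_ℝ) {t : ℝ} (ht : 0 ≤ t) (f : E) :
    ‖T t f‖ ≤ ‖f‖ := by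
  rcases ht.eq_or_lt with rfl | ht
  · simp [hT.map_zero]
  choose h hd using fun s : Ioi (0 : ℝ) => hT.heatEquation f s s.2
  have hanti : AntitoneOn (fun s => ⟪T s f, T s f⟫_ℝ) (Icc 0 t) := by
    have hder : ∀ s ∈ Ioo 0 t, ∃ d ≤ 0, HasDerivAt (fun s => ⟪T s f, T s f⟫_ℝ) d s := by
      intro s hs
      refine ⟨_, ?_, (hd ⟨s, hs.1⟩).inner ℝ (hd ⟨s, hs.1⟩)⟩
      have := hL ⟨_, h ⟨s, hs.1⟩⟩
      have h2 := real_inner_comm (T s f) (L ⟨_, h ⟨s, hs.1⟩⟩)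
      simp only [inner_neg_right, inner_neg_left] at this h2 ⊢
      linarith
    have hcont : ContinuousOn (fun s => T s f) (Icc 0 t) :=
      (hT.continuousOn f).mono Icc_subset_Ici_self
    refine antitoneOn_of_deriv_nonpos (convex_Icc _ _) (hcont.inner hcont) ?_ ?_
    · intro s hs
      rw [interior_Icc] at hs
      obtain ⟨d, -, hd⟩ := hder s hs
      exact hd.differentiableAt.differentiableWithinAt
    · intro s hs
      rw [interior_Icc] at hs
      obtain ⟨d, hd0, hd⟩ := hder s hs
      rwa [hd.deriv]
  have h0 := hanti (left_mem_Icc.mpr ht.le) (right_mem_Icc.mpr ht.le) ht.le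
  simp only [real_inner_self_eq_norm_sq, hT.map_zero, ContinuousLinearMap.id_apply] at h0
  exact le_of_sq_le_sq h0 (norm_nonneg _)

/-- The function `s ↦ e^{ls} ⟪T s g, e⟫` is constant, since symmetry moves `L` onto the eigenvector.
-/
theorem IsHeatSemigroup.inner_eigenvector (hT : IsHeatSemigroup L T)
    (hL : ∀ x y : L.domain, ⟪L x, (y : E)⟫_ℝ = ⟪(x : E), L y⟫_ℝ) {t : ℝ} (ht : 0 ≤ t)
    {l : ℝ} {e : E} (he : e ∈ eigenspace L l) (g : E) :
    ⟪T t g, e⟫_ℝ = Real.exp (-l * t) * ⟪g, e⟫_ℝ := by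
  rcases ht.eq_or_lt with rfl | ht
  · simp [hT.map_zero]
  obtain ⟨he, hle⟩ := mem_eigenspace.mp he
  choose h hd using fun s : Ioi (0 : ℝ) => hT.heatEquation g s s.2
  obtain ⟨c, -, hc⟩ := exists_hasDerivAt_eq_slope (fun s => Real.exp (l * s) * ⟪T s g, e⟫_ℝ)
    (fun _ => 0) ht
    (ContinuousOn.mul (by fun_prop)
      (((hT.continuousOn g).mono Icc_subset_Ici_self).inner continuousOn_const))
    (fun s hs => by
      have h1 := (hd ⟨s, hs.1⟩).inner ℝ (hasDerivAt_const s e)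
      have h2 : HasDerivAt (fun s => Real.exp (l * s)) (Real.exp (l * s) * l) s := by
        simpa using ((hasDerivAt_id s).const_mul l).exp
      refine (h2.mul h1).congr_deriv ?_
      have := hL ⟨_, h ⟨s, hs.1⟩⟩ ⟨e, he⟩
      rw [hle] at this
      simp only [inner_smul_right, inner_neg_left, inner_zero_right] at this ⊢
      rw [this]
      ring)
  rw [eq_comm, div_eq_zero_iff] at hc
  rcases hc with hc | hc
  · simp only [hT.map_zero, mul_zero, Real.exp_zero, one_mul, ContinuousLinearMap.id_apply] at hc
    rw [← sub_eq_zero.mp hc, ← mul_assoc, ← Real.exp_add]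
    simp
  · linarith

theorem IsHeatSemigroup.apply_eigenvector (hT : IsHeatSemigroup L T)
    (hL : ∀ x y : L.domain, ⟪L x, (y : E)⟫_ℝ = ⟪(x : E), L y⟫_ℝ) {t : ℝ} (ht : 0 ≤ t)
    {l : ℝ} {e : E} (he : e ∈ eigenspace L l) : T t e = Real.exp (-l * t) • e := by
  refine ext_inner_left ℝ fun g => ?_
  rw [← hT.inner_comm hL ht, hT.inner_eigenvector hL ht he, inner_smul_right]

theorem IsHeatSemigroup.map_lowSpan_orthogonal (hT : IsHeatSemigroup L T)
    (hL : ∀ x y : L.domain, ⟪L x, (y : E)⟫_ℝ = ⟪(x : E), L y⟫_ℝ) {t : ℝ} (ht : 0 ≤ t)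
    {ω : ℝ} {g : E} (hg : g ∈ (lowSpan L ω)ᗮ) : T t g ∈ (lowSpan L ω)ᗮ := by
  rw [mem_lowSpan_orthogonal] at hg ⊢
  intro l hl e he
  rw [real_inner_comm, hT.inner_eigenvector hL ht he, real_inner_comm, hg l hl e he, mul_zero]

/-- A self-adjoint operator has norm equal to its spectral radius, and the nonzero spectrum of a
compact one consists of eigenvalues. -/
theorem norm_apply_le_of_forall_hasEigenvalue {F : Type*} [NormedAddCommGroup F]
    [InnerProductSpace ℝ F] [CompleteSpace F] {S : F →L[ℝ] F} (hS : IsCompactOperator S)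
    (hS' : S.IsSymmetric) {θ : ℝ} (hθ : 0 ≤ θ)
    (h : ∀ σ, Module.End.HasEigenvalue (S : Module.End ℝ F) σ → |σ| ≤ θ) (v : F) :
    ‖S v‖ ≤ θ * ‖v‖ := by
  refine S.le_of_opNorm_le ?_ v
  have h1 : spectralRadius ℝ S ≤ ENNReal.ofReal θ := by
    refine iSup₂_le fun σ hσ => ?_
    rw [← enorm_eq_nnnorm, ← ofReal_norm, Real.norm_eq_abs]
    refine ENNReal.ofReal_le_ofReal ?_
    by_cases h0 : σ = 0
    · simpa [h0] using hθ
    · exact h σ ((hS.hasEigenvalue_iff_mem_spectrum h0).mpr hσ)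
  rw [S.spectralRadius_eq_nnnorm hS'.isSelfAdjoint] at h1
  rw [← ENNReal.ofReal_le_ofReal_iff hθ]
  simpa [ofReal_norm, enorm_eq_nnnorm] using h1

/-- A larger norm would give `T t` an eigenvalue `σ` on the complement with `|σ| > e^{-ωt}`. The
corresponding finite-dimensional eigenspace is `L`-invariant, so it contains an eigenvector of `L`,
with eigenvalue `l` say. Then `σ = e^{-lt}` forces `l ≤ ω`, and the vector is orthogonal to itself.
-/
theorem IsHeatSemigroup.norm_le_of_mem_lowSpan_orthogonal [CompleteSpace E]
    (hT : IsHeatSemigroup L T)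
    (hL : ∀ x y : L.domain, ⟪L x, (y : E)⟫_ℝ = ⟪(x : E), L y⟫_ℝ) {t : ℝ} (ht : 0 < t)
    (hc : IsCompactOperator (T t)) {ω : ℝ} {w : E} (hw : w ∈ (lowSpan L ω)ᗮ) :
    ‖T t w‖ ≤ Real.exp (-ω * t) * ‖w‖ := by
  have hinv : ∀ v ∈ (lowSpan L ω)ᗮ, T t v ∈ (lowSpan L ω)ᗮ :=
    fun v hv => hT.map_lowSpan_orthogonal hL ht.le hv
  have hfd := ContinuousLinearMap.finite_dimensional_eigenspace hc
  refine norm_apply_le_of_forall_hasEigenvalue (F := (lowSpan L ω)ᗮ) (S := (T t).restrict hinv)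
    (hc.restrict' hinv)
    (fun x y => hT.inner_comm hL ht.le x y) (Real.exp_pos _).le ?_ ⟨w, hw⟩
  intro σ hσ
  by_contra! hlt
  have hσ0 : σ ≠ 0 := by
    rintro rfl
    simp only [abs_zero] at hlt
    exact absurd hlt (Real.exp_pos _).not_gt
  set V : Submodule ℝ E := (lowSpan L ω)ᗮ ⊓ Module.End.eigenspace (T t).toLinearMap σ with hV
  have hVmem : ∀ v, v ∈ V ↔ v ∈ (lowSpan L ω)ᗮ ∧ T t v = σ • v := by
    intro v
    rw [hV, Submodule.mem_inf, Module.End.mem_eigenspace_iff]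
    rfl
  have := hfd σ hσ0
  have : FiniteDimensional ℝ V := Submodule.finiteDimensional_of_le inf_le_right
  -- As `v = T t (σ⁻¹ v)`, smoothing puts `v` in the domain and makes `-L v` the time derivative of
  -- an orbit at `t`.
  have hVL : ∀ v ∈ V, ∃ h : v ∈ L.domain, L ⟨v, h⟩ ∈ V := by
    intro v hv
    obtain ⟨hv1, hv2⟩ := (hVmem v).mp hv
    have hv3 : T t (σ⁻¹ • v) = v := by
      rw [map_smul, hv2, smul_smul, inv_mul_cancel₀ hσ0, one_smul]
    obtain ⟨h, hd⟩ := hT.heatEquation (σ⁻¹ • v) t ht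
    have hdom : v ∈ L.domain := hv3 ▸ h
    have hLv : L ⟨T t (σ⁻¹ • v), h⟩ = L ⟨v, hdom⟩ := by congr 1; exact Subtype.ext hv3
    rw [hLv] at hd
    refine ⟨hdom, (hVmem _).mpr ⟨?_, ?_⟩⟩
    · rw [mem_lowSpan_orthogonal] at hv1 ⊢
      intro l hl e he
      obtain ⟨hed, hle⟩ := mem_eigenspace.mp he
      have := hL ⟨e, hed⟩ ⟨v, hdom⟩
      rw [hle, inner_smul_left, hv1 l hl e he, mul_zero] at this
      exact this.symm
    · have h1 := (T t).hasFDerivAt.comp_hasDerivAt t hd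
      have h2 := hd.const_smul σ
      -- `T t` and `T s` commute; differentiating this identity at `s = t` yields `T t (L v) = σ L
      -- v`.
      have h3 : (fun s => T t (T s (σ⁻¹ • v))) =ᶠ[𝓝 t] fun s => σ • T s (σ⁻¹ • v) := by
        filter_upwards [lt_mem_nhds ht] with s hs
        have := hT.map_add t s ht.le hs.le
        have h' := hT.map_add s t hs.le ht.le
        rw [add_comm, this] at h'
        have := congrArg (fun A : E →L[ℝ] E => A (σ⁻¹ • v)) h'
        simp only [ContinuousLinearMap.comp_apply] at this
        rw [this, map_smul (T t), hv2, smul_comm, map_smul]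
      have h4 := (h2.congr_of_eventuallyEq h3).unique h1
      simp only [smul_neg, map_neg, neg_inj] at h4
      exact h4.symm
  let A : V →ₗ[ℝ] V :=
    { toFun := fun v => ⟨L ⟨v, (hVL v v.2).1⟩, (hVL v v.2).2⟩
      map_add' := fun v w => Subtype.ext (L.map_add ⟨v, (hVL v v.2).1⟩ ⟨w, (hVL w w.2).1⟩)
      map_smul' := fun c v => Subtype.ext (L.map_smul c ⟨v, (hVL v v.2).1⟩) }
  have hA : A.IsSymmetric := fun v w => hL ⟨v, (hVL v v.2).1⟩ ⟨w, (hVL w w.2).1⟩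
  obtain ⟨⟨x, hx⟩, hx1, hx2⟩ := hσ.exists_hasEigenvector
  have hxV : x ∈ V := by
    refine (hVmem x).mpr ⟨hx, ?_⟩
    have := Module.End.mem_eigenspace_iff.mp hx1
    exact congrArg Subtype.val this
  have : Nontrivial V := ⟨⟨⟨x, hxV⟩, 0, fun h => hx2 (Subtype.ext (congrArg (fun v : V => (v : E)) h))⟩⟩
  obtain ⟨l, hl⟩ : ∃ l : ℝ, Module.End.HasEigenvalue A l :=
    ⟨_, hA.hasEigenvalue_iSup_of_finiteDimensional⟩
  obtain ⟨v, hv1, hv2⟩ := hl.exists_hasEigenvector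
  rw [Module.End.mem_eigenspace_iff] at hv1
  have hve : (v : E) ∈ eigenspace L l :=
    mem_eigenspace.mpr ⟨(hVL v v.2).1, congrArg Subtype.val hv1⟩
  have hv0 : (v : E) ≠ 0 := fun h => hv2 (Subtype.ext h)
  obtain ⟨hvo, hvσ⟩ := (hVmem v).mp v.2
  have hexp : σ = Real.exp (-l * t) := by
    have := hT.apply_eigenvector hL ht.le hve
    rw [hvσ] at this
    exact smul_left_injective ℝ hv0 this
  rw [hexp, abs_of_pos (Real.exp_pos _), Real.exp_lt_exp] at hlt
  have hlω : l ≤ ω := by nlinarith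
  have := mem_lowSpan_orthogonal.mp hvo l hlω v hve
  exact hv0 (inner_self_eq_zero.mp this)

end Hilbert

/-! ### Eigenvalue counting as a dimension -/

section Counting

variable {E : Type*} [NormedAddCommGroup E] [InnerProductSpace ℝ E] {L : E →ₗ.[ℝ] E}

open scoped InnerProductSpace

/-- The trace of an orthogonal projection along a finite orthonormal family. -/
theorem sum_norm_sq_starProjection_le (M : Submodule ℝ E) [FiniteDimensional ℝ M] {ι : Type*}
    {u : ι → E} (hu : Orthonormal ℝ u) (s : Finset ι) :
    ∑ i ∈ s, ‖M.starProjection (u i)‖ ^ 2 ≤ Module.finrank ℝ M := by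
  set b := stdOrthonormalBasis ℝ M
  have h1 : ∀ i, ‖M.starProjection (u i)‖ ^ 2 = ∑ j, ‖⟪u i, (b j : E)⟫_ℝ‖ ^ 2 := by
    intro i
    have h := b.sum_sq_norm_inner_left (M.orthogonalProjectionOnto (u i))
    rw [Submodule.starProjection_apply, Submodule.norm_coe, ← h]
    refine Finset.sum_congr rfl fun j _ => ?_
    rw [Submodule.inner_orthogonalProjectionOnto_eq_of_mem_right]
  calc ∑ i ∈ s, ‖M.starProjection (u i)‖ ^ 2
      = ∑ j, ∑ i ∈ s, ‖⟪u i, (b j : E)⟫_ℝ‖ ^ 2 := by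
        rw [Finset.sum_comm]
        exact Finset.sum_congr rfl fun i _ => h1 i
    _ ≤ ∑ j, ‖(b j : E)‖ ^ 2 := Finset.sum_le_sum fun j _ => hu.sum_inner_products_le (b j : E)
    _ = Module.finrank ℝ M := by
        have : ∀ j, ‖(b j : E)‖ = 1 := fun j => b.orthonormal.1 j
        simp [this]

/-- With `u = p + q` along `lowSpan L ω` and its complement, `⟪T (2r) u, u⟫ = ‖T r p‖² + ‖T r q‖²`.
At `r = 2t`, contractivity bounds the first term by `‖p‖²` and spectral decay bounds the second by
`e^{-2ωt} ‖T t q‖²`; at `r = t` the identity gives `‖T t q‖² ≤ B`. Thus `‖p‖² ≥ A - e^{-2ωt} B`, and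
these are summed by the trace bound. -/
theorem IsHeatSemigroup.card_mul_le_finrank [CompleteSpace E] {T : ℝ → E →L[ℝ] E}
    (hT : IsHeatSemigroup L T)
    (hL : ∀ x y : L.domain, ⟪L x, (y : E)⟫_ℝ = ⟪(x : E), L y⟫_ℝ)
    (hL0 : ∀ x : L.domain, 0 ≤ ⟪L x, (x : E)⟫_ℝ) {t : ℝ} (ht : 0 < t)
    (hc : IsCompactOperator (T t)) {ω : ℝ} [FiniteDimensional ℝ (lowSpan L ω)]
    {ι : Type*} {u : ι → E} (hu : Orthonormal ℝ u) {A B : ℝ}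
    (hA : ∀ i, A ≤ ⟪T (4 * t) (u i), u i⟫_ℝ) (hB : ∀ i, ⟪T (2 * t) (u i), u i⟫_ℝ ≤ B)
    (s : Finset ι) :
    s.card * (A - Real.exp (-(2 * ω * t)) * B) ≤ Module.finrank ℝ (lowSpan L ω) := by
  refine le_trans ?_ (sum_norm_sq_starProjection_le (lowSpan L ω) hu s)
  rw [← nsmul_eq_mul]
  refine Finset.card_nsmul_le_sum _ _ _ fun i _ => ?_
  have key : ∀ r : ℝ, 0 ≤ r → ∀ f g : E, ⟪T (2 * r) f, g⟫_ℝ = ⟪T r f, T r g⟫_ℝ := by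
    intro r hr f g
    rw [two_mul, hT.map_add r r hr hr, ContinuousLinearMap.comp_apply, hT.inner_comm hL hr]
  set M := lowSpan L ω
  set p := M.starProjection (u i) with hp
  set q := u i - p with hq
  have hpM : p ∈ M := Submodule.starProjection_apply_mem _ _
  have hqM : q ∈ Mᗮ := Submodule.sub_starProjection_mem_orthogonal _
  have hsum : u i = p + q := by simp [hq]
  have pyth : ∀ r : ℝ, 0 ≤ r →
      ⟪T r (u i), T r (u i)⟫_ℝ = ‖T r p‖ ^ 2 + ‖T r q‖ ^ 2 := by
    intro r hr
    have h0 : ⟪T r p, T r q⟫_ℝ = 0 := by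
      rw [hT.inner_comm hL hr]
      exact hT.map_lowSpan_orthogonal hL hr (hT.map_lowSpan_orthogonal hL hr hqM) _ hpM
    rw [real_inner_self_eq_norm_sq, hsum, _root_.map_add, sq, sq, sq,
      norm_add_sq_eq_norm_sq_add_norm_sq_of_inner_eq_zero _ _ h0]
  have h4 := hA i
  have h2 := hB i
  rw [show 4 * t = 2 * (2 * t) by ring, key _ (by positivity), pyth _ (by positivity)] at h4
  rw [key _ ht.le, pyth _ ht.le] at h2
  have hp1 : ‖T (2 * t) p‖ ^ 2 ≤ ‖p‖ ^ 2 :=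
    pow_le_pow_left₀ (norm_nonneg _) (hT.norm_le hL0 (by positivity) p) 2
  have hq1 : ‖T (2 * t) q‖ ≤ Real.exp (-ω * t) * ‖T t q‖ := by
    rw [two_mul, hT.map_add t t ht.le ht.le, ContinuousLinearMap.comp_apply]
    exact hT.norm_le_of_mem_lowSpan_orthogonal hL ht hc (hT.map_lowSpan_orthogonal hL ht.le hqM)
  have hq2 : ‖T (2 * t) q‖ ^ 2 ≤ Real.exp (-(2 * ω * t)) * ‖T t q‖ ^ 2 := by
    refine (pow_le_pow_left₀ (norm_nonneg _) hq1 2).trans_eq ?_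
    rw [mul_pow, ← Real.exp_nat_mul]
    congr 2
    push_cast
    ring
  have hB' : Real.exp (-(2 * ω * t)) * ‖T t q‖ ^ 2 ≤ Real.exp (-(2 * ω * t)) * B := by
    refine mul_le_mul_of_nonneg_left ?_ (Real.exp_pos _).le
    linarith [sq_nonneg ‖T t p‖]
  linarith

theorem orthogonalFamily_eigenspace
    (hL : ∀ x y : L.domain, ⟪L x, (y : E)⟫_ℝ = ⟪(x : E), L y⟫_ℝ) :
    OrthogonalFamily ℝ (fun l => eigenspace L l) fun l => (eigenspace L l).subtypeₗᵢ := by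
  rintro l m hlm ⟨v, hv⟩ ⟨w, hw⟩
  obtain ⟨hvd, hv⟩ := mem_eigenspace.mp hv
  obtain ⟨hwd, hw⟩ := mem_eigenspace.mp hw
  have h := hL ⟨v, hvd⟩ ⟨w, hwd⟩
  rw [hv, hw, inner_smul_left, inner_smul_right, ← sub_eq_zero, ← sub_mul] at h
  exact (mul_eq_zero.mp h).resolve_left (sub_ne_zero.mpr hlm)

variable {ω : ℝ}

theorem finrank_biSup_eigenspace (hL : ∀ x y : L.domain, ⟪L x, (y : E)⟫_ℝ = ⟪(x : E), L y⟫_ℝ)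
    (hfin : ∀ l : Iic ω, FiniteDimensional ℝ (eigenspace L (l : ℝ))) (s : Finset (Iic ω)) :
    FiniteDimensional ℝ (⨆ l ∈ s, eigenspace L (l : ℝ) : Submodule ℝ E) ∧
      Module.finrank ℝ (⨆ l ∈ s, eigenspace L (l : ℝ) : Submodule ℝ E) =
        ∑ l ∈ s, Module.finrank ℝ (eigenspace L (l : ℝ)) := by
  classical
  induction s using Finset.induction_on with
  | empty =>
    rw [show (⨆ l ∈ (∅ : Finset (Iic ω)), eigenspace L (l : ℝ) : Submodule ℝ E) = ⊥ by simp]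
    exact ⟨inferInstance, by simp⟩
  | insert a s ha ih =>
    rw [Finset.iSup_insert, Finset.sum_insert ha, ← ih.2]
    have := ih.1
    refine ⟨inferInstance, ?_⟩
    have hdisj : Disjoint (eigenspace L (a : ℝ)) (⨆ l ∈ s, eigenspace L (l : ℝ)) :=
      ((orthogonalFamily_eigenspace hL).comp Subtype.val_injective).independent.disjoint_biSup
        (x := a) (y := (s : Set (Iic ω))) (by simpa using ha)
    have h := Submodule.finrank_sup_add_finrank_inf_eq (eigenspace L (a : ℝ))
      (⨆ l ∈ s, eigenspace L (l : ℝ))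
    rwa [hdisj.eq_bot, finrank_bot, add_zero] at h

theorem eigenvalueCount_eq_tsum_finrank
    (hfin : ∀ l : Iic ω, FiniteDimensional ℝ (eigenspace L (l : ℝ))) :
    eigenvalueCount L ω = ∑' l : Iic ω, (Module.finrank ℝ (eigenspace L (l : ℝ)) : ℝ≥0∞) := by
  refine tsum_congr fun l => ?_
  rw [← Module.finrank_eq_rank ℝ (eigenspace L (l : ℝ)), map_natCast, ENat.toENNReal_coe]

theorem finrank_lowSpan_le_eigenvalueCount
    (hL : ∀ x y : L.domain, ⟪L x, (y : E)⟫_ℝ = ⟪(x : E), L y⟫_ℝ)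
    (h : eigenvalueCount L ω ≠ ⊤) :
    FiniteDimensional ℝ (lowSpan L ω) ∧
      (Module.finrank ℝ (lowSpan L ω) : ℝ≥0∞) ≤ eigenvalueCount L ω := by
  have hfin : ∀ l : Iic ω, FiniteDimensional ℝ (eigenspace L (l : ℝ)) := by
    intro l
    have := ENNReal.ne_top_of_tsum_ne_top h l
    by_contra hl
    refine this ?_
    have : Cardinal.toENat (Module.rank ℝ (eigenspace L (l : ℝ))) = ⊤ := by
      rw [Cardinal.toENat_eq_top]
      rw [FiniteDimensional, ← Module.rank_lt_aleph0_iff, not_lt] at hl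
      exact hl
    rw [this]
    rfl
  rw [eigenvalueCount_eq_tsum_finrank hfin] at h ⊢
  -- A finite sum of natural numbers has finitely many terms at least `1`, so only finitely many
  -- eigenspaces are nonzero.
  have hsupp := ENNReal.finite_const_le_of_tsum_ne_top h one_ne_zero
  have hbot : ∀ l : Iic ω, l ∉ hsupp.toFinset → eigenspace L (l : ℝ) = ⊥ := by
    intro l hl
    simp only [Finite.mem_toFinset, mem_ofPred_eq, not_le] at hl
    have : ((Module.finrank ℝ (eigenspace L (l : ℝ)) : ℕ) : ℝ≥0∞) < (1 : ℕ) := by simpa using hl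
    exact Submodule.finrank_eq_zero.mp (by have := Nat.cast_lt.mp this; omega)
  have hspan : lowSpan L ω = ⨆ l ∈ hsupp.toFinset, eigenspace L (l : ℝ) := by
    refine le_antisymm (iSup_le fun l => ?_)
      (iSup₂_le fun l _ => le_iSup (fun l : Iic ω => eigenspace L (l : ℝ)) l)
    by_cases hl : l ∈ hsupp.toFinset
    · exact le_iSup₂_of_le l hl le_rfl
    · rw [hbot l hl]
      exact bot_le
  have key := finrank_biSup_eigenspace hL hfin hsupp.toFinset
  rw [← hspan] at key
  refine ⟨key.1, ?_⟩
  rw [key.2, Nat.cast_sum]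
  exact ENNReal.sum_le_tsum _

/-- A linear map that is injective on the sums of eigenvectors with eigenvalues at most `ω`
bounds the number of these eigenvalues by the dimension of its target. -/
theorem eigenvalueCount_le_of_injective
    (hL : ∀ x y : L.domain, ⟪L x, (y : E)⟫_ℝ = ⟪(x : E), L y⟫_ℝ) {ι : Type*} [Fintype ι]
    (φ : lowSpan L ω →ₗ[ℝ] (ι → ℝ)) (hφ : Function.Injective φ) :
    eigenvalueCount L ω ≤ Fintype.card ι := by
  have : FiniteDimensional ℝ (lowSpan L ω) := FiniteDimensional.of_injective φ hφ
  have hcard : Module.finrank ℝ (lowSpan L ω) ≤ Fintype.card ι := by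
    simpa using LinearMap.finrank_le_finrank_of_injective hφ
  have hle : ∀ l : Iic ω, eigenspace L (l : ℝ) ≤ lowSpan L ω :=
    fun l => le_iSup (fun l : Iic ω => eigenspace L (l : ℝ)) l
  have hfin : ∀ l : Iic ω, FiniteDimensional ℝ (eigenspace L (l : ℝ)) :=
    fun l => Submodule.finiteDimensional_of_le (hle l)
  rw [eigenvalueCount_eq_tsum_finrank hfin, ENNReal.tsum_eq_iSup_sum]
  refine iSup_le fun s => ?_
  rw [← Nat.cast_sum, ← (finrank_biSup_eigenspace hL hfin s).2, Nat.cast_le]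
  exact (Submodule.finrank_mono (iSup₂_le fun l _ => hle l)).trans hcard

end Counting

/-! ### Smoothness and energy of sums of low eigenvectors -/

section Energy

open scoped InnerProductSpace

theorem add_mem_powDomain {E : Type*} [AddCommGroup E] [Module ℝ E] {L : E →ₗ.[ℝ] E} (k : ℕ) :
    ∀ {f g : E}, f ∈ powDomain L k → g ∈ powDomain L k → f + g ∈ powDomain L k := by
  induction k with
  | zero => exact fun _ _ => mem_univ _
  | succ k ih =>
    rintro f g ⟨hf, hf'⟩ ⟨hg, hg'⟩
    exact ⟨add_mem hf hg, by simpa [← LinearPMap.map_add] using ih hf' hg'⟩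

theorem smul_mem_powDomain {E : Type*} [AddCommGroup E] [Module ℝ E] {L : E →ₗ.[ℝ] E} (k : ℕ) :
    ∀ (c : ℝ) {f : E}, f ∈ powDomain L k → c • f ∈ powDomain L k := by
  induction k with
  | zero => exact fun _ _ _ => mem_univ _
  | succ k ih =>
    rintro c f ⟨hf, hf'⟩
    exact ⟨Submodule.smul_mem _ c hf, by simpa [← LinearPMap.map_smul] using ih c hf'⟩

variable {E : Type*} [NormedAddCommGroup E] [InnerProductSpace ℝ E] {L : E →ₗ.[ℝ] E} {ω : ℝ}

theorem mem_powDomain_of_mem_eigenspace {l : ℝ} {f : E} (hf : f ∈ eigenspace L l) (k : ℕ) :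
    f ∈ powDomain L k := by
  induction k with
  | zero => exact mem_univ _
  | succ k ih =>
    obtain ⟨h, hf⟩ := mem_eigenspace.mp hf
    exact ⟨h, hf ▸ smul_mem_powDomain k l ih⟩

theorem mem_smoothDomain_of_mem_lowSpan {f : E} (hf : f ∈ lowSpan L ω) : f ∈ smoothDomain L := by
  refine mem_iInter.mpr fun k => ?_
  refine Submodule.iSup_induction (fun l : Iic ω => eigenspace L (l : ℝ))
    (motive := fun f => f ∈ powDomain L k) hf
    (fun l f hf => mem_powDomain_of_mem_eigenspace hf k) ?_ (fun f g => add_mem_powDomain k)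
  exact mem_powDomain_of_mem_eigenspace (zero_mem (eigenspace L 0)) k

theorem mem_domain_of_mem_smoothDomain {f : E} (hf : f ∈ smoothDomain L) : f ∈ L.domain :=
  (mem_iInter.mp hf 1).1

/-- Expand `f` in mutually orthogonal eigenvectors: both sides become sums of `‖v l‖²` with weights
`l ≤ ω`. -/
theorem inner_le_of_mem_lowSpan
    (hL : ∀ x y : L.domain, ⟪L x, (y : E)⟫_ℝ = ⟪(x : E), L y⟫_ℝ) {f : E} (hf : f ∈ lowSpan L ω)
    (h : f ∈ L.domain) : ⟪L ⟨f, h⟩, f⟫_ℝ ≤ ω * ‖f‖ ^ 2 := by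
  obtain ⟨v, hv, hvf⟩ := (Submodule.mem_iSup_iff_exists_finsupp _ _).mp hf
  have hd : ∀ l, v l ∈ L.domain := fun l => (mem_eigenspace.mp (hv l)).1
  have hLv : ∀ l, L ⟨v l, hd l⟩ = (l : ℝ) • v l := fun l => (mem_eigenspace.mp (hv l)).2
  have horth : ∀ l ∈ v.support, ∀ m ∈ v.support, l ≠ m → ⟪v l, v m⟫_ℝ = 0 := fun l _ m _ hlm =>
    orthogonalFamily_eigenspace hL (fun h => hlm (Subtype.ext h)) ⟨v l, hv l⟩ ⟨v m, hv m⟩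
  have hf' : f = ∑ l ∈ v.support, v l := hvf.symm
  have hfd : (⟨f, h⟩ : L.domain) = ∑ l ∈ v.support, ⟨v l, hd l⟩ :=
    Subtype.ext (by simp [hf'])
  have hLf : L ⟨f, h⟩ = ∑ l ∈ v.support, (l : ℝ) • v l := by
    rw [hfd, ← LinearPMap.toFun_eq_coe, map_sum]
    exact Finset.sum_congr rfl fun l _ => hLv l
  have hdiag : ∀ l ∈ v.support, ⟪v l, f⟫_ℝ = ‖v l‖ ^ 2 := by
    intro l hl
    rw [hf', inner_sum, Finset.sum_eq_single_of_mem l hl fun m hm hml => horth l hl m hm hml.symm,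
      real_inner_self_eq_norm_sq]
  have hnorm : ‖f‖ ^ 2 = ∑ l ∈ v.support, ‖v l‖ ^ 2 := by
    rw [← real_inner_self_eq_norm_sq]
    nth_rewrite 1 [hf']
    rw [sum_inner]
    exact Finset.sum_congr rfl hdiag
  rw [hLf, sum_inner, hnorm, Finset.mul_sum]
  refine Finset.sum_le_sum fun l hl => ?_
  rw [real_inner_smul_left, hdiag l hl]
  exact mul_le_mul_of_nonneg_right l.2 (sq_nonneg _)

end Energy

/-! ### Doubling measures and lattices -/

section Geometry

open Metric

variable {X : Type*} [MetricSpace X]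

/-- In a compact space, the centres of disjoint balls of a fixed radius form a finite set. -/
theorem finite_of_pairwiseDisjoint_ball [CompactSpace X] {ρ : ℝ} (hρ : 0 < ρ) {S : Set X}
    (hS : S.PairwiseDisjoint fun x => ball x (ρ / 2)) : S.Finite := by
  obtain ⟨t, ht, hc⟩ :=
    totallyBounded_iff.mp (isCompact_univ (X := X)).totallyBounded (ρ / 2) (by positivity)
  have h : ∀ x : X, ∃ y ∈ t, dist x y < ρ / 2 := fun x => by simpa using hc (mem_univ x)
  choose f hf hd using h
  refine Finite.of_injOn (f := f) (t := t) (fun x _ => hf x) (fun x hx y hy hxy => ?_) ht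
  by_contra hne
  refine disjoint_left.mp (hS hx hy hne) (mem_ball'.mpr (hd x)) ?_
  rw [hxy]
  exact mem_ball'.mpr (hd y)

section Doubling

variable [MeasurableSpace X] {μ : Measure X}

theorem IsDoubling.pos (hA : IsDoubling μ) (x : X) {r : ℝ} (hr : 0 < r) :
    0 < μ.real (ball x r) := by
  obtain ⟨D, -, h⟩ := hA
  have := (h x (r / 2) (by positivity)).1
  rwa [mul_div_cancel₀ r two_ne_zero] at this

/-- The doubling condition with a natural exponent, iterated. -/
theorem IsDoubling.exists_pow (hA : IsDoubling μ) :
    ∃ D : ℝ, 0 < D ∧ ∀ (k : ℕ) (x : X) (r : ℝ), 0 < r →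
      μ.real (ball x (2 ^ k * r)) ≤ ((2 : ℝ) ^ D) ^ k * μ.real (ball x r) := by
  obtain ⟨D, hD, h⟩ := hA
  refine ⟨D, hD, fun k x r hr => ?_⟩
  induction k with
  | zero => simp
  | succ k ih =>
    have := (h x (2 ^ k * r) (by positivity)).2
    rw [pow_succ', mul_assoc, pow_succ', mul_assoc]
    exact this.trans (by gcongr)

/-- A fixed number of doublings enlarges every ball of radius `r` to the whole bounded space. This
is what makes the heat kernel bounded at a fixed time. -/
theorem IsDoubling.exists_le_measureReal_ball [CompactSpace X] [Nonempty X] (hA : IsDoubling μ)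
    {r : ℝ} (hr : 0 < r) : ∃ m : ℝ, 0 < m ∧ ∀ x : X, m ≤ μ.real (ball x r) := by
  obtain ⟨D, hD, h⟩ := hA.exists_pow
  obtain ⟨R, hR⟩ : ∃ R : ℝ, ∀ x y : X, dist x y < R := by
    refine ⟨diam (univ : Set X) + 1, fun x y => ?_⟩
    have := dist_le_diam_of_mem isCompact_univ.isBounded (mem_univ x) (mem_univ y)
    linarith
  obtain ⟨k, hk⟩ := pow_unbounded_of_one_lt (R / r) one_lt_two
  have hball : ∀ x : X, ball x (2 ^ k * r) = univ := fun x => eq_univ_of_forall fun y =>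
    mem_ball.mpr ((hR y x).trans ((div_lt_iff₀ hr).mp hk))
  obtain ⟨x₀⟩ := ‹Nonempty X›
  have hpos : 0 < μ.real univ := hball x₀ ▸ hA.pos x₀ (by positivity)
  refine ⟨μ.real univ / ((2 : ℝ) ^ D) ^ k, by positivity, fun x => ?_⟩
  rw [div_le_iff₀' (by positivity), ← hball x]
  exact h k x r hr

/-- Gives access to Lebesgue differentiation; passing from open to closed balls costs one extra
doubling. -/
theorem IsDoubling.isUnifLocDoublingMeasure [IsFiniteMeasure μ] (hA : IsDoubling μ) : IsUnifLocDoublingMeasure μ := by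
  obtain ⟨D, hD, h⟩ := hA.exists_pow
  refine ⟨(((2 : ℝ) ^ D) ^ 2).toNNReal, ?_⟩
  filter_upwards [self_mem_nhdsWithin] with ε hε x
  have hε : 0 < ε := hε
  have h1 : μ.real (closedBall x (2 * ε)) ≤ ((2 : ℝ) ^ D) ^ 2 * μ.real (closedBall x ε) := by
    calc μ.real (closedBall x (2 * ε)) ≤ μ.real (ball x (2 ^ 2 * ε)) :=
          measureReal_mono (closedBall_subset_ball (by linarith))
      _ ≤ ((2 : ℝ) ^ D) ^ 2 * μ.real (ball x ε) := h 2 x ε hε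
      _ ≤ _ := by
        gcongr
        · exact measure_ne_top _ _
        · exact ball_subset_closedBall
  rw [← ENNReal.ofReal_toReal (measure_ne_top μ (closedBall x (2 * ε))),
    ← ENNReal.ofReal_toReal (measure_ne_top μ (closedBall x ε)),
    ← ENNReal.ofReal, ← ENNReal.ofReal_mul (by positivity)]
  exact ENNReal.ofReal_le_ofReal h1

variable [OpensMeasurableSpace X] [IsFiniteMeasure μ]

/-- Volume packing: the disjoint balls `B(x, ρ/2)` lie in `B(y, 2ρ)`, which in turn lies in each
`B(x, 4ρ)`, three doublings away. The bound depends only on the measure. -/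
theorem IsDoubling.encard_le (hA : IsDoubling μ) :
    ∃ N : ℕ, ∀ ρ : ℝ, 0 < ρ → ∀ S : Set X, (S.PairwiseDisjoint fun x => ball x (ρ / 2)) →
      ∀ y : X, {x ∈ S | y ∈ ball x ρ}.encard ≤ N := by
  obtain ⟨D, hD, h⟩ := hA.exists_pow
  refine ⟨⌊((2 : ℝ) ^ D) ^ 3⌋₊, fun ρ hρ S hS y => ?_⟩
  have hfin : ∀ F : Finset X, (F : Set X) ⊆ {x ∈ S | y ∈ ball x ρ} →
      F.card ≤ ⌊((2 : ℝ) ^ D) ^ 3⌋₊ := by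
    intro F hF
    refine Nat.le_floor ?_
    have hV : 0 < μ.real (ball y (2 * ρ)) := hA.pos y (by positivity)
    have hlow : ∀ x ∈ F, μ.real (ball y (2 * ρ)) ≤ ((2 : ℝ) ^ D) ^ 3 * μ.real (ball x (ρ / 2)) := by
      intro x hx
      refine le_trans (measureReal_mono ?_) (h 3 x (ρ / 2) (by positivity))
      refine ball_subset_ball' ?_
      have := (hF hx).2
      rw [mem_ball] at this
      linarith
    have hsum : ∑ x ∈ F, μ.real (ball x (ρ / 2)) ≤ μ.real (ball y (2 * ρ)) := by
      rw [← measureReal_biUnion_finset (fun a ha b hb => hS (hF ha).1 (hF hb).1)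
        (fun x _ => measurableSet_ball)]
      refine measureReal_mono (iUnion₂_subset fun x hx => ball_subset_ball' ?_)
      have := (hF hx).2
      rw [mem_ball, dist_comm] at this
      linarith
    have := Finset.card_nsmul_le_sum F _ _ hlow
    rw [← Finset.mul_sum, nsmul_eq_mul] at this
    have h2 : (F.card : ℝ) * μ.real (ball y (2 * ρ)) ≤
        ((2 : ℝ) ^ D) ^ 3 * μ.real (ball y (2 * ρ)) := this.trans (by gcongr)
    exact le_of_mul_le_mul_right h2 hV
  by_contra! hlt
  have h1 : ((⌊((2 : ℝ) ^ D) ^ 3⌋₊ + 1 : ℕ) : ℕ∞) ≤ {x ∈ S | y ∈ ball x ρ}.encard := by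
    exact_mod_cast Order.add_one_le_of_lt hlt
  obtain ⟨t, ht, htc⟩ := exists_subset_encard_eq h1
  have htf : t.Finite := finite_of_encard_eq_coe htc
  have := hfin htf.toFinset (by simpa using ht)
  rw [htf.encard_eq_coe_toFinset_card] at htc
  have := ENat.natCast_inj.mp htc
  omega

/-- A maximal family of disjoint balls of radius `ρ/2` works: a point at distance at least `ρ` from
every centre could be added. -/
theorem IsDoubling.exists_isLattice (hA : IsDoubling μ) :
    ∃ N : ℕ, ∀ ρ : ℝ, 0 < ρ → ∃ S : Set X, IsLattice ρ N S := by
  obtain ⟨N, hN⟩ := hA.encard_le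
  refine ⟨N, fun ρ hρ => ?_⟩
  obtain ⟨S, hS⟩ := zorn_subset {S : Set X | S.PairwiseDisjoint fun x => ball x (ρ / 2)}
    (fun c hc hchain => ⟨⋃₀ c, (pairwiseDisjoint_sUnion hchain.directedOn).mpr fun s hs => hc hs,
      fun s hs => subset_sUnion_of_mem hs⟩)
  refine ⟨S, hS.1, eq_univ_of_forall fun y => ?_, hN ρ hρ S hS.1⟩
  by_contra hy
  simp only [mem_iUnion, not_exists] at hy
  have hyS : y ∉ S := fun h => hy y h (mem_ball_self hρ)
  refine hyS (hS.2 (y := insert y S) ?_ (subset_insert _ _) (mem_insert _ _))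
  refine hS.1.insert fun x hx _ => ?_
  refine ball_disjoint_ball ?_
  have := hy x hx
  rw [mem_ball, not_lt] at this
  linarith

end Doubling

end Geometry

/-! ### Comparing integrals with sums over covering balls -/

section Coverings

open Metric

variable {X : Type*} [MetricSpace X] [MeasurableSpace X] [OpensMeasurableSpace X] {μ : Measure X}

theorem integral_le_sum_setIntegral {g : X → ℝ} (hg : Integrable g μ) (hg0 : 0 ≤ᵐ[μ] g)
    {ρ : ℝ} (F : Finset X) (hF : ⋃ x ∈ F, ball x ρ = univ) :
    ∫ y, g y ∂μ ≤ ∑ x ∈ F, ∫ y in ball x ρ, g y ∂μ := by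
  simp_rw [← integral_indicator measurableSet_ball]
  rw [← integral_finsetSum _ fun x _ => hg.indicator measurableSet_ball]
  refine integral_mono_ae hg (integrable_finsetSum _ fun x _ => hg.indicator measurableSet_ball) ?_
  filter_upwards [hg0] with y hy
  obtain ⟨x, hx, hyx⟩ := mem_iUnion₂.mp (hF ▸ mem_univ y)
  have := Finset.single_le_sum (f := fun x => (ball x ρ).indicator g y)
    (fun x _ => indicator_apply_nonneg fun _ => hy) hx
  simpa [indicator_of_mem hyx] using this

theorem sum_setIntegral_le {g : X → ℝ} (hg : Integrable g μ) (hg0 : 0 ≤ᵐ[μ] g)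
    {ρ : ℝ} (F : Finset X) {N : ℕ} (hF : ∀ y, {x ∈ (F : Set X) | y ∈ ball x ρ}.encard ≤ N) :
    ∑ x ∈ F, ∫ y in ball x ρ, g y ∂μ ≤ N * ∫ y, g y ∂μ := by
  classical
  simp_rw [← integral_indicator measurableSet_ball]
  rw [← integral_finsetSum _ fun x _ => hg.indicator measurableSet_ball, ← integral_const_mul]
  refine integral_mono_ae (integrable_finsetSum _ fun x _ => hg.indicator measurableSet_ball)
    (hg.const_mul _) ?_
  filter_upwards [hg0] with y hy
  have hcard : (F.filter fun x => y ∈ ball x ρ).card ≤ N := by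
    have := hF y
    have hcoe : {x ∈ (F : Set X) | y ∈ ball x ρ} = F.filter fun x => y ∈ ball x ρ := by
      ext x
      simp
    rw [hcoe, encard_coe_eq_coe_finsetCard] at this
    exact_mod_cast this
  simp only [indicator_apply]
  rw [← Finset.sum_filter, Finset.sum_const, nsmul_eq_mul]
  exact mul_le_mul_of_nonneg_right (by exact_mod_cast hcard) hy

end Coverings

/-! ### Poincaré inequality on lattices and the upper bound -/

section UpperBound

open Metric
open scoped InnerProductSpace

variable {X : Type*} [MetricSpace X] [CompactSpace X] [MeasurableSpace X] [BorelSpace X]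
  {μ : Measure X} [IsFiniteMeasure μ] {L : Lp ℝ 2 μ →ₗ.[ℝ] Lp ℝ 2 μ}

theorem integrable_gam (f : C(X, ℝ)) : Integrable (Gam L f f) μ := by
  have hf : MemLp f 2 μ :=
    (memLp_congr_ae (ContinuousMap.coeFn_toLp (p := 2) (𝕜 := ℝ) μ f)).mp (Lp.memLp _)
  have h1 := hf.integrable_mul (Lp.memLp (applyOp L f))
  have h2 := (Lp.memLp (applyOp L (f * f))).integrable one_le_two
  exact ((h1.add h1).sub h2).const_mul (1 / 2)

/-- Lebesgue differentiation, run along closed balls; each closed ball is a decreasing intersection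
of open ones. -/
theorem nonneg_ae_of_setIntegral_ball_nonneg (hA : IsDoubling μ) {g : X → ℝ} (hg : Integrable g μ)
    {ρ₀ : ℝ} (hρ₀ : 0 < ρ₀)
    (h : ∀ (x : X) (ρ : ℝ), 0 < ρ → ρ < ρ₀ → 0 ≤ ∫ y in ball x ρ, g y ∂μ) : 0 ≤ᵐ[μ] g := by
  have := hA.isUnifLocDoublingMeasure
  have hclosed : ∀ (x : X) (ρ : ℝ), 0 < ρ → ρ < ρ₀ → 0 ≤ ∫ y in closedBall x ρ, g y ∂μ := by
    intro x ρ hρ hρ'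
    obtain ⟨u, hu, hu', hlim⟩ := exists_seq_strictAnti_tendsto' hρ'
    have hint : closedBall x ρ = ⋂ n, ball x (u n) := by
      ext y
      simp only [mem_closedBall, mem_iInter, mem_ball]
      refine ⟨fun hy n => hy.trans_lt (hu' n).1, fun hy => ?_⟩
      exact ge_of_tendsto' hlim fun n => (hy n).le
    rw [hint]
    refine ge_of_tendsto' (tendsto_setIntegral_of_antitone (fun n => measurableSet_ball)
      (fun m n hmn => ball_subset_ball (hu.antitone hmn)) ⟨0, hg.integrableOn⟩) fun n => ?_
    exact h x (u n) (hρ.trans (hu' n).1) (hu' n).2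
  filter_upwards [IsUnifLocDoublingMeasure.ae_tendsto_average μ hg.locallyIntegrable 1] with x hx
  obtain ⟨u, -, hu', hlim⟩ := exists_seq_strictAnti_tendsto' hρ₀
  have hlim' : Tendsto u atTop (𝓝[>] 0) :=
    tendsto_nhdsWithin_iff.mpr ⟨hlim, Eventually.of_forall fun n => (hu' n).1⟩
  refine ge_of_tendsto' (hx (fun _ => x) u hlim' (Eventually.of_forall fun n => ?_)) fun n => ?_
  · exact mem_closedBall_self (by rw [one_mul]; exact (hu' n).1.le)
  · rw [setAverage_eq]
    exact smul_nonneg (inv_nonneg.mpr measureReal_nonneg) (hclosed x (u n) (hu' n).1 (hu' n).2)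

theorem norm_toL2_sq (f : C(X, ℝ)) : ‖toL2 μ f‖ ^ 2 = ∫ x, f x ^ 2 ∂μ := by
  rw [← real_inner_self_eq_norm_sq, L2.inner_def]
  refine integral_congr_ae ?_
  filter_upwards [ContinuousMap.coeFn_toLp (p := 2) (𝕜 := ℝ) μ f] with x hx
  rw [hx, real_inner_self_eq_norm_sq, Real.norm_eq_abs, sq_abs]

theorem integrable_sq (f : C(X, ℝ)) : Integrable (fun x => f x ^ 2) μ :=
  ((memLp_congr_ae (ContinuousMap.coeFn_toLp (p := 2) (𝕜 := ℝ) μ f)).mp (Lp.memLp _)).integrable_sq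

/-- The global Poincaré inequality for functions with vanishing means over the balls of a
lattice. -/
theorem exists_norm_sq_le_of_setIntegral_eq_zero (hA : IsDoubling μ) (hC : GradientBound L)
    (hD : LocalPoincare L) :
    ∃ K ρ₀ : ℝ, 0 < K ∧ 0 < ρ₀ ∧ ∀ ρ : ℝ, 0 < ρ → ρ < ρ₀ → ∀ (N : ℕ) (S : Set X),
      IsLattice ρ N S → ∀ f : C(X, ℝ), toL2 μ f ∈ smoothDomain L →
        (∀ x ∈ S, ∫ y in ball x ρ, f y ∂μ = 0) →
          ‖toL2 μ f‖ ^ 2 ≤ K * ρ ^ 2 * ⟪applyOp L f, toL2 μ f⟫_ℝ := by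
  obtain ⟨c, hc, hC⟩ := hC
  obtain ⟨C, ρ₀, hC0, hρ₀, hD⟩ := hD
  -- The overlap is bounded by `M` from doubling rather than by the lattice's own `N`, so that `K`,
  -- and later `γ`, is independent of `N`. The factor `M + 1` keeps `K` positive even if `M = 0`.
  obtain ⟨M, hM⟩ := hA.encard_le
  refine ⟨C * (M + 1) * c, ρ₀, by positivity, hρ₀, fun ρ hρ hρ' N S hS f hf hz => ?_⟩
  have hSf := finite_of_pairwiseDisjoint_ball hρ hS.disjoint
  -- Nonnegativity of `Γ(f,f)` is not assumed; the Poincaré inequality makes its integral over every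
  -- small ball nonnegative.
  have hgam : 0 ≤ᵐ[μ] Gam L f f := by
    refine nonneg_ae_of_setIntegral_ball_nonneg hA (integrable_gam f) hρ₀ fun x r hr hr' => ?_
    have h1 := hD f hf x r hr hr'
    have h2 : 0 ≤ ∫ y in ball x r, (f y - ⨍ z in ball x r, f z ∂μ) ^ 2 ∂μ :=
      integral_nonneg fun _ => sq_nonneg _
    exact nonneg_of_mul_nonneg_right (h2.trans h1) (by positivity)
  have hball : ∀ x ∈ hSf.toFinset,
      ∫ y in ball x ρ, f y ^ 2 ∂μ ≤ C * ρ ^ 2 * ∫ y in ball x ρ, Gam L f f y ∂μ := by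
    intro x hx
    have := hD f hf x ρ hρ hρ'
    rw [setAverage_eq, hz x (hSf.mem_toFinset.mp hx)] at this
    simpa using this
  calc ‖toL2 μ f‖ ^ 2 = ∫ x, f x ^ 2 ∂μ := norm_toL2_sq f
    _ ≤ ∑ x ∈ hSf.toFinset, ∫ y in ball x ρ, f y ^ 2 ∂μ :=
        integral_le_sum_setIntegral (integrable_sq f) (Eventually.of_forall fun _ => sq_nonneg _) _
          (by simpa using hS.cover)
    _ ≤ ∑ x ∈ hSf.toFinset, C * ρ ^ 2 * ∫ y in ball x ρ, Gam L f f y ∂μ :=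
        Finset.sum_le_sum hball
    _ = C * ρ ^ 2 * ∑ x ∈ hSf.toFinset, ∫ y in ball x ρ, Gam L f f y ∂μ := by
        rw [Finset.mul_sum]
    _ ≤ C * ρ ^ 2 * (M * ∫ y, Gam L f f y ∂μ) := by
        gcongr
        exact sum_setIntegral_le (integrable_gam f) hgam _ (by simpa using hM ρ hρ S hS.disjoint)
    _ ≤ C * ρ ^ 2 * ((M + 1) * (c * ⟪applyOp L f, toL2 μ f⟫_ℝ)) := by
        have h1 : 0 ≤ ∫ y, Gam L f f y ∂μ := integral_nonneg_of_ae hgam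
        have h2 := hC f hf
        gcongr
        linarith
    _ = C * (M + 1) * c * ρ ^ 2 * ⟪applyOp L f, toL2 μ f⟫_ℝ := by ring

theorem exists_eigenvalueCount_le (hA : IsDoubling μ)
    (hL : ∀ x y : L.domain, ⟪L x, (y : Lp ℝ 2 μ)⟫_ℝ = ⟪(x : Lp ℝ 2 μ), L y⟫_ℝ)
    (hB : SmoothDomainIsSubalgebra L) (hC : GradientBound L) (hD : LocalPoincare L) :
    ∃ γ : ℝ, 0 < γ ∧ γ < 1 ∧ ∀ᶠ ω : ℝ in atTop, ∀ (N : ℕ) (S : Set X),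
      IsLattice (γ * ω ^ (-(1 / 2) : ℝ)) N S → eigenvalueCount L ω ≤ (S.encard : ℝ≥0∞) := by
  obtain ⟨K, ρ₀, hK, hρ₀, hP⟩ := exists_norm_sq_le_of_setIntegral_eq_zero hA hC hD
  obtain ⟨A, hA'⟩ := hB
  -- With `γ = 1 / (2 + K)` one has both `γ < 1` and `K γ² < 1`.
  have hγ : (0 : ℝ) < 1 / (2 + K) := by positivity
  have hγ1 : 1 / (2 + K) < 1 := by rw [div_lt_one (by positivity)]; linarith
  refine ⟨1 / (2 + K), hγ, hγ1, ?_⟩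
  have hlim : Tendsto (fun ω : ℝ => ω ^ (-(1 / 2) : ℝ)) atTop (𝓝 0) :=
    tendsto_rpow_neg_atTop (by norm_num)
  filter_upwards [eventually_gt_atTop 0, hlim.eventually (gt_mem_nhds hρ₀)] with ω hω hωρ N S hS
  set r := ω ^ (-(1 / 2) : ℝ) with hr
  have hr0 : 0 < r := Real.rpow_pos_of_pos hω _
  have hrω : r ^ 2 * ω = 1 := by
    rw [hr, ← Real.rpow_natCast, ← Real.rpow_mul hω.le]
    norm_num [Real.rpow_neg_one, inv_mul_cancel₀ hω.ne']
  set ρ := 1 / (2 + K) * r with hρ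
  have hρ0 : 0 < ρ := by positivity
  have hρlt : ρ < ρ₀ := lt_of_le_of_lt (by nlinarith) hωρ
  have hSf := finite_of_pairwiseDisjoint_ball hρ0 hS.disjoint
  have := hSf.fintype
  rw [encard_eq_coe_toFinset_card, ENat.toENNReal_coe, toFinset_card]
  let φ : Lp ℝ 2 μ →ₗ[ℝ] (S → ℝ) := LinearMap.pi fun x =>
    (innerSL ℝ (indicatorConstLp 2 (measurableSet_ball (x := (x : X)) (ε := ρ))
      (measure_ne_top μ _) (1 : ℝ))).toLinearMap
  have hφ : ∀ (f : Lp ℝ 2 μ) (x : S), φ f x = ∫ y in ball (x : X) ρ, f y ∂μ := fun f x =>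
    L2.inner_indicatorConstLp_one _ _ _
  refine eigenvalueCount_le_of_injective hL (φ ∘ₗ (lowSpan L ω).subtype) ?_
  rw [← LinearMap.ker_eq_bot, LinearMap.ker_eq_bot']
  rintro ⟨f, hf⟩ hφf
  have hfs := mem_smoothDomain_of_mem_lowSpan hf
  have hfd := mem_domain_of_mem_smoothDomain hfs
  -- The algebra hypothesis supplies a continuous representative, to which the Poincaré inequality
  -- applies.
  obtain ⟨g, -, hg⟩ : f ∈ (toL2 μ) '' (A : Set C(X, ℝ)) := hA' ▸ hfs
  subst hg
  have hz : ∀ x ∈ S, ∫ y in ball x ρ, g y ∂μ = 0 := by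
    intro x hx
    refine Eq.trans ?_ ((hφ (toL2 μ g) ⟨x, hx⟩).symm.trans (congrFun hφf ⟨x, hx⟩))
    exact integral_congr_ae (ae_restrict_of_ae
      (ContinuousMap.coeFn_toLp (p := 2) (𝕜 := ℝ) μ g).symm)
  have h1 := hP ρ hρ0 hρlt N S hS g hfs hz
  have h2 := inner_le_of_mem_lowSpan hL hf hfd
  rw [applyOp, dif_pos hfd] at h1
  have h3 : ‖toL2 μ g‖ ^ 2 ≤ K * ρ ^ 2 * (ω * ‖toL2 μ g‖ ^ 2) :=
    h1.trans (mul_le_mul_of_nonneg_left h2 (by positivity))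
  have h4 : K * ρ ^ 2 * (ω * ‖toL2 μ g‖ ^ 2) = K / (2 + K) ^ 2 * ‖toL2 μ g‖ ^ 2 := by
    rw [hρ]
    calc _ = K / (2 + K) ^ 2 * ‖toL2 μ g‖ ^ 2 * (r ^ 2 * ω) := by field_simp
      _ = _ := by rw [hrω, mul_one]
  have h5 : K / (2 + K) ^ 2 < 1 := by
    rw [div_lt_one (by positivity)]
    nlinarith
  rw [h4] at h3
  have h6 : ‖toL2 μ g‖ ^ 2 = 0 := by nlinarith [sq_nonneg ‖toL2 μ g‖]
  exact Subtype.ext (norm_eq_zero.mp (pow_eq_zero_iff two_ne_zero |>.mp h6))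

end UpperBound

/-! ### Compactness of Hilbert–Schmidt operators -/

section HilbertSchmidt

open scoped InnerProductSpace

variable {E : Type*} [NormedAddCommGroup E] [InnerProductSpace ℝ E]

/-- An orthonormal family with all `‖S u‖ > ε` has at most `K / ε²` members. Take the span of a
longest one: a bad vector orthogonal to it, once normalized, would extend the family. -/
theorem exists_finiteDimensional_norm_le {S : E →L[ℝ] E} {K : ℝ}
    (h : ∀ (n : ℕ) (u : Fin n → E), Orthonormal ℝ u → ∑ i, ‖S (u i)‖ ^ 2 ≤ K) {ε : ℝ}
    (hε : 0 < ε) : ∃ M : Submodule ℝ E, FiniteDimensional ℝ M ∧ ∀ v ∈ Mᗮ, ‖S v‖ ≤ ε * ‖v‖ := by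
  obtain ⟨n, ⟨u, hu, huε⟩, hn⟩ : ∃ n : ℕ,
      (∃ u : Fin n → E, Orthonormal ℝ u ∧ ∀ i, ε < ‖S (u i)‖) ∧
        ¬ ∃ u : Fin (n + 1) → E, Orthonormal ℝ u ∧ ∀ i, ε < ‖S (u i)‖ := by
    by_contra! hcon
    have hall : ∀ n : ℕ, ∃ u : Fin n → E, Orthonormal ℝ u ∧ ∀ i, ε < ‖S (u i)‖ := by
      intro n
      induction n with
      | zero => exact ⟨Fin.elim0, ⟨fun i => i.elim0, fun i => i.elim0⟩, fun i => i.elim0⟩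
      | succ n ih => exact hcon n ih
    obtain ⟨n, hn⟩ := exists_nat_gt (K / ε ^ 2)
    obtain ⟨u, hu, huε⟩ := hall n
    have h1 := Finset.card_nsmul_le_sum Finset.univ (fun i => ‖S (u i)‖ ^ 2) (ε ^ 2)
      fun i _ => pow_le_pow_left₀ hε.le (huε i).le 2
    rw [Finset.card_univ, Fintype.card_fin, nsmul_eq_mul] at h1
    rw [div_lt_iff₀ (by positivity)] at hn
    linarith [h n u hu]
  refine ⟨Submodule.span ℝ (range u), FiniteDimensional.span_of_finite ℝ (finite_range u),
    fun v hv => ?_⟩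
  by_contra! hlt
  have hv0 : 0 < ‖v‖ := by
    refine norm_pos_iff.mpr fun h0 => ?_
    simp [h0] at hlt
  refine hn ⟨Matrix.vecCons (‖v‖⁻¹ • v) u, orthonormal_vecCons_iff.mpr ⟨?_, fun i => ?_, hu⟩, ?_⟩
  · rw [norm_smul, norm_inv, norm_norm, inv_mul_cancel₀ hv0.ne']
  · rw [inner_smul_left, real_inner_comm, hv _ (Submodule.subset_span (mem_range_self i)), mul_zero]
  · refine Fin.cases ?_ (fun i => by simpa using huε i)
    rw [Matrix.cons_val_zero, map_smul, norm_smul, norm_inv, norm_norm, inv_mul_eq_div,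
      lt_div_iff₀ hv0]
    exact hlt

/-- A Hilbert–Schmidt operator is compact. -/
theorem isCompactOperator_of_sum_norm_sq_le [CompleteSpace E] {S : E →L[ℝ] E} {K : ℝ}
    (h : ∀ (n : ℕ) (u : Fin n → E), Orthonormal ℝ u → ∑ i, ‖S (u i)‖ ^ 2 ≤ K) :
    IsCompactOperator S := by
  choose M hM hMS using fun n : ℕ =>
    exists_finiteDimensional_norm_le h (Nat.one_div_pos_of_nat (α := ℝ) (n := n))
  -- `S` is the norm limit of its finite-rank compositions with the projections onto `M n`, with
  -- error at most `1 / (n + 1)`.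
  refine isCompactOperator_of_tendsto (l := atTop)
    (F := fun n => S.comp ((M n).starProjection)) ?_ (Eventually.of_forall fun n => ?_)
  · refine tendsto_iff_norm_sub_tendsto_zero.mpr (squeeze_zero (fun _ => norm_nonneg _)
      (fun n => ?_) tendsto_one_div_add_atTop_nhds_zero_nat)
    rw [norm_sub_rev]
    refine ContinuousLinearMap.opNorm_le_bound _ Nat.one_div_pos_of_nat.le fun v => ?_
    have h1 := hMS n (v - (M n).starProjection v)
      (Submodule.sub_starProjection_mem_orthogonal v)
    have h2 : ‖v - (M n).starProjection v‖ ≤ ‖v‖ := by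
      have := (M n)ᗮ.norm_starProjection_apply_le v
      rwa [Submodule.starProjection_orthogonal_val] at this
    calc ‖(S - S.comp (M n).starProjection) v‖ = ‖S (v - (M n).starProjection v)‖ := by
          simp [map_sub]
      _ ≤ 1 / ((n : ℝ) + 1) * ‖v - (M n).starProjection v‖ := h1
      _ ≤ 1 / ((n : ℝ) + 1) * ‖v‖ := by gcongr
  · have hid : IsCompactOperator (id : M n → M n) := isCompactOperator_id
    exact (hid.clm_comp (S.comp (M n).subtypeL)).comp_clm (M n).orthogonalProjectionOnto

end HilbertSchmidt

/-! ### Integral operators tested on indicators -/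

section KernelOperators

open scoped InnerProductSpace

variable {X : Type*} [MeasurableSpace X] {μ : Measure X}

theorem norm_sq_eq_integral (f : Lp ℝ 2 μ) : ‖f‖ ^ 2 = ∫ x, f x ^ 2 ∂μ := by
  rw [← real_inner_self_eq_norm_sq, L2.inner_def]
  exact integral_congr_ae (Eventually.of_forall fun x => by
    simp only [real_inner_self_eq_norm_sq, Real.norm_eq_abs, sq_abs])

variable [IsFiniteMeasure μ] {S : Lp ℝ 2 μ →L[ℝ] Lp ℝ 2 μ} {k : X → X → ℝ}

/-- For almost every `x`, `S (u i) x` is the inner product of `u i` with the row `k x`; Bessel's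
inequality row by row gives the Hilbert–Schmidt bound. -/
theorem isCompactOperator_of_bounded_kernel (hk : Measurable (Function.uncurry k)) {C : ℝ}
    (hkC : ∀ x y, |k x y| ≤ C)
    (hS : ∀ f : Lp ℝ 2 μ, (S f : X → ℝ) =ᵐ[μ] fun x => ∫ y, k x y * f y ∂μ) :
    IsCompactOperator S := by
  refine isCompactOperator_of_sum_norm_sq_le (K := ∫ _, C ^ 2 * μ.real univ ∂μ) fun n u hu => ?_
  have hint : ∀ i, Integrable (fun x => S (u i) x ^ 2) μ := fun i =>
    (Lp.memLp (S (u i))).integrable_sq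
  simp_rw [norm_sq_eq_integral]
  rw [← integral_finsetSum _ fun i _ => hint i]
  refine integral_mono_ae (integrable_finsetSum _ fun i _ => hint i) (integrable_const _) ?_
  filter_upwards [ae_all_iff.mpr fun i => hS (u i)] with x hx
  have hmem : MemLp (k x) 2 μ :=
    MemLp.of_bound (hk.comp measurable_prodMk_left).aestronglyMeasurable C
      (Eventually.of_forall fun y => hkC x y)
  have hinner : ∀ i, S (u i) x = ⟪u i, hmem.toLp⟫_ℝ := by
    intro i
    rw [hx i, L2.inner_def]
    refine integral_congr_ae ?_
    filter_upwards [hmem.coeFn_toLp] with y hy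
    rw [hy]
    rfl
  calc ∑ i, S (u i) x ^ 2 = ∑ i, ‖⟪u i, hmem.toLp⟫_ℝ‖ ^ 2 := by simp [hinner]
    _ ≤ ‖hmem.toLp‖ ^ 2 := hu.sum_inner_products_le _
    _ = ∫ y, k x y ^ 2 ∂μ := by
        rw [norm_sq_eq_integral]
        refine integral_congr_ae ?_
        filter_upwards [hmem.coeFn_toLp] with y hy
        rw [hy]
    _ ≤ ∫ _, C ^ 2 ∂μ := integral_mono hmem.integrable_sq (integrable_const _) fun y =>
        sq_le_sq' (abs_le.mp (hkC x y)).1 (abs_le.mp (hkC x y)).2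
    _ = C ^ 2 * μ.real univ := by simp [mul_comm]

theorem inner_indicator_mem_Icc
    (hS : ∀ f : Lp ℝ 2 μ, (∀ᵐ x ∂μ, Integrable (fun y => k x y * f y) μ) ∧
      (S f : X → ℝ) =ᵐ[μ] fun x => ∫ y, k x y * f y ∂μ)
    {B : Set X} (hB : MeasurableSet B) {a b : ℝ} (hk : ∀ x ∈ B, ∀ y ∈ B, k x y ∈ Icc a b) :
    ⟪S (indicatorConstLp 2 hB (measure_ne_top μ B) (1 : ℝ)),
      indicatorConstLp 2 hB (measure_ne_top μ B) (1 : ℝ)⟫_ℝ ∈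
        Icc (a * μ.real B ^ 2) (b * μ.real B ^ 2) := by
  set e := indicatorConstLp 2 hB (measure_ne_top μ B) (1 : ℝ) with he
  have hcoe : (e : X → ℝ) =ᵐ[μ] B.indicator fun _ => (1 : ℝ) := indicatorConstLp_coeFn
  have hconst : ∀ c : ℝ, ∫ y, c * e y ∂μ = c * μ.real B := by
    intro c
    rw [integral_const_mul, integral_congr_ae hcoe, integral_indicator hB]
    simp
  have heint : Integrable e μ := (Lp.memLp e).integrable one_le_two
  have hrow : ∀ᵐ x ∂μ, x ∈ B → S e x ∈ Icc (a * μ.real B) (b * μ.real B) := by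
    filter_upwards [(hS e).1, (hS e).2] with x hx1 hx2 hxB
    rw [hx2, ← hconst a, ← hconst b]
    constructor
    · refine integral_mono_ae (heint.const_mul a) hx1 ?_
      filter_upwards [hcoe] with y hy
      by_cases hyB : y ∈ B
      · simpa [hy, hyB] using (hk x hxB y hyB).1
      · simp [hy, hyB]
    · refine integral_mono_ae hx1 (heint.const_mul b) ?_
      filter_upwards [hcoe] with y hy
      by_cases hyB : y ∈ B
      · simpa [hy, hyB] using (hk x hxB y hyB).2
      · simp [hy, hyB]
  have hSint : IntegrableOn (S e) B μ := ((Lp.memLp (S e)).integrable one_le_two).integrableOn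
  have hset : ∀ c : ℝ, ∫ _ in B, c * μ.real B ∂μ = c * μ.real B ^ 2 := by
    intro c
    rw [setIntegral_const, smul_eq_mul]
    ring
  rw [real_inner_comm, L2.inner_indicatorConstLp_one, ← hset a, ← hset b]
  exact ⟨setIntegral_mono_on_ae (integrableOn_const (measure_ne_top _ _)) hSint hB
      (hrow.mono fun x hx hxB => (hx hxB).1),
    setIntegral_mono_on_ae hSint (integrableOn_const (measure_ne_top _ _)) hB
      (hrow.mono fun x hx hxB => (hx hxB).2)⟩

/-- The indicator of `B`, normalized in `L₂`. -/
noncomputable def normalizedIndicator (μ : Measure X) [IsFiniteMeasure μ] {B : Set X}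
    (hB : MeasurableSet B) : Lp ℝ 2 μ :=
  (√(μ.real B))⁻¹ • indicatorConstLp 2 hB (measure_ne_top μ B) (1 : ℝ)

theorem inner_normalizedIndicator_mem_Icc
    (hS : ∀ f : Lp ℝ 2 μ, (∀ᵐ x ∂μ, Integrable (fun y => k x y * f y) μ) ∧
      (S f : X → ℝ) =ᵐ[μ] fun x => ∫ y, k x y * f y ∂μ)
    {B : Set X} (hB : MeasurableSet B) (hB0 : 0 < μ.real B) {a b : ℝ}
    (hk : ∀ x ∈ B, ∀ y ∈ B, k x y ∈ Icc a b) :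
    ⟪S (normalizedIndicator μ hB), normalizedIndicator μ hB⟫_ℝ ∈
      Icc (a * μ.real B) (b * μ.real B) := by
  have h := inner_indicator_mem_Icc hS hB hk
  have hsq : (√(μ.real B))⁻¹ * (√(μ.real B))⁻¹ = (μ.real B)⁻¹ := by
    rw [← mul_inv, Real.mul_self_sqrt hB0.le]
  rw [normalizedIndicator, map_smul, real_inner_smul_left, real_inner_smul_right, ← mul_assoc, hsq,
    inv_mul_eq_div, mem_Icc, le_div_iff₀ hB0, div_le_iff₀ hB0, mul_assoc, mul_assoc, ← sq]
  exact h

theorem orthonormal_normalizedIndicator {ι : Type*} {B : ι → Set X}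
    (hB : ∀ i, MeasurableSet (B i)) (hB0 : ∀ i, 0 < μ.real (B i))
    (hdisj : Pairwise fun i j => Disjoint (B i) (B j)) :
    Orthonormal ℝ fun i => normalizedIndicator μ (hB i) := by
  classical
  rw [orthonormal_iff_ite]
  intro i j
  rw [normalizedIndicator, normalizedIndicator, real_inner_smul_left, real_inner_smul_right,
    L2.real_inner_indicatorConstLp_one_indicatorConstLp_one]
  split_ifs with hij
  · subst hij
    rw [inter_self, ← mul_assoc, ← mul_inv, Real.mul_self_sqrt (hB0 i).le,
      inv_mul_cancel₀ (hB0 i).ne']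
  · rw [(hdisj hij).inter_eq]
    simp

end KernelOperators

/-! ### Gaussian estimates and the lower bound -/

section LowerBound

open Metric
open scoped InnerProductSpace

variable {X : Type*} [MetricSpace X] [MeasurableSpace X] {μ : Measure X}

theorem gaussian_le {C c t m : ℝ} (hC : 0 < C) (hc : 0 < c) (ht : 0 < t)
    (hm : 0 < m) {x y : X} (hx : m ≤ μ.real (ball x √t)) (hy : m ≤ μ.real (ball y √t)) :
    C * Real.exp (-c * dist x y ^ 2 / t) / √(μ.real (ball x √t) * μ.real (ball y √t)) ≤ C / m := by
  have h1 : m ≤ √(μ.real (ball x √t) * μ.real (ball y √t)) :=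
    Real.le_sqrt_of_sq_le (by rw [sq]; gcongr)
  have h2 : Real.exp (-c * dist x y ^ 2 / t) ≤ 1 := by
    rw [Real.exp_le_one_iff, neg_mul, neg_div, neg_nonpos]
    positivity
  gcongr
  exact mul_le_of_le_one_right hC.le h2

theorem le_gaussian (hA : IsDoubling μ) {C c t M : ℝ} (hC : 0 < C) (hc : 0 < c) (ht : 0 < t)
    {x y : X} (hxy : dist x y ^ 2 ≤ t) (hx : μ.real (ball x √t) ≤ M)
    (hy : μ.real (ball y √t) ≤ M) :
    C * Real.exp (-c) / M ≤
      C * Real.exp (-c * dist x y ^ 2 / t) / √(μ.real (ball x √t) * μ.real (ball y √t)) := by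
  have hx0 := hA.pos x (Real.sqrt_pos.mpr ht)
  have hy0 := hA.pos y (Real.sqrt_pos.mpr ht)
  have h1 : √(μ.real (ball x √t) * μ.real (ball y √t)) ≤ M := by
    refine Real.sqrt_le_iff.mpr ⟨hx0.le.trans hx, ?_⟩
    rw [sq]
    gcongr
    exact hx0.le.trans hx
  gcongr
  rw [mul_div_assoc, neg_mul, neg_le_neg_iff]
  exact mul_le_of_le_one_right hc.le ((div_le_one ht).mpr hxy)

/-- The volume loss `(2^q)^k = (4^k)^{q/2}` is a power of `4^k`, hence beaten by `e^{-4^k/2}`. -/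
theorem exists_pow_four_exp_le {q A B : ℝ} (hA : 0 < A) :
    ∃ k : ℕ, 1 ≤ k ∧ Real.exp (-((4 : ℝ) ^ k / 2)) * B ≤ A / ((2 : ℝ) ^ q) ^ (k + 2) := by
  have h1 := (tendsto_rpow_mul_exp_neg_mul_atTop_nhds_zero (q / 2) (1 / 2) (by norm_num)).comp
    (tendsto_pow_atTop_atTop_of_one_lt (by norm_num : (1 : ℝ) < 4))
  have h2 := h1.mul_const (((2 : ℝ) ^ q) ^ 2 * B)
  rw [zero_mul] at h2
  obtain ⟨k, hk1, hk⟩ := ((eventually_ge_atTop 1).and (h2.eventually (gt_mem_nhds hA))).exists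
  refine ⟨k, hk1, ?_⟩
  rw [le_div_iff₀ (by positivity)]
  refine le_trans (le_of_eq ?_) hk.le
  have h4 : ((4 : ℝ) ^ k) ^ (q / 2) = ((2 : ℝ) ^ q) ^ k := by
    rw [show (4 : ℝ) = 2 ^ (2 : ℝ) by norm_num, ← Real.rpow_natCast, ← Real.rpow_natCast,
      ← Real.rpow_mul (by norm_num), ← Real.rpow_mul (by norm_num), ← Real.rpow_mul (by norm_num)]
    congr 1
    ring
  simp only [Function.comp]
  rw [h4, show -(1 / 2) * (4 : ℝ) ^ k = -(4 ^ k / 2) by ring]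
  ring

variable [CompactSpace X] [BorelSpace X] [IsFiniteMeasure μ] {L : Lp ℝ 2 μ →ₗ.[ℝ] Lp ℝ 2 μ}

theorem exists_mul_encard_le_eigenvalueCount (hA : IsDoubling μ)
    (hL : ∀ x y : L.domain, ⟪L x, (y : Lp ℝ 2 μ)⟫_ℝ = ⟪(x : Lp ℝ 2 μ), L y⟫_ℝ)
    (hL0 : ∀ x : L.domain, 0 ≤ ⟪L x, (x : Lp ℝ 2 μ)⟫_ℝ) (hE : HasGaussianHeatKernel L) :
    ∃ c : ℝ, 0 < c ∧ c < 1 ∧ ∀ᶠ ω : ℝ in atTop, ∀ (N : ℕ) (S : Set X),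
      IsLattice (ω ^ (-(1 / 2) : ℝ)) N S →
        ENNReal.ofReal c * (S.encard : ℝ≥0∞) ≤ eigenvalueCount L ω := by
  obtain ⟨P, ⟨T, hT, hP⟩, C₁, C₂, c₁, c₂, hC₁, hC₂, hc₁, hc₂, hG⟩ := hE
  obtain ⟨D, -, hdoub⟩ := hA.exists_pow
  -- Choosing `k` for half the constant makes the error `e^{-4^k/2} C₂` at most half the main term
  -- `C₁ e^{-c₁} / G`. The minimum with `1/2` below only ensures `c < 1`.
  have hA₀ : 0 < C₁ * Real.exp (-c₁) / 2 := by positivity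
  obtain ⟨k, hk1, hk⟩ := exists_pow_four_exp_le (B := C₂) (q := D) hA₀
  set G := ((2 : ℝ) ^ D) ^ (k + 2) with hGdef
  have hG0 : 0 < G := by positivity
  refine ⟨min (C₁ * Real.exp (-c₁) / 2 / G) (1 / 2), by positivity,
    (min_le_right _ _).trans_lt (by norm_num), ?_⟩
  -- This makes `4s = 4^k / ω < 1`, the range of the heat kernel estimates.
  filter_upwards [eventually_gt_atTop ((4 : ℝ) ^ k)] with ω hω N S hS
  have hω0 : 0 < ω := lt_trans (by positivity) hω
  set ρ := ω ^ (-(1 / 2) : ℝ) with hρ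
  have hρ0 : 0 < ρ := Real.rpow_pos_of_pos hω0 _
  have hρω : ρ ^ 2 * ω = 1 := by
    rw [hρ, ← Real.rpow_natCast, ← Real.rpow_mul hω0.le]
    norm_num [Real.rpow_neg_one, inv_mul_cancel₀ hω0.ne']
  by_cases hfin : eigenvalueCount L ω = ⊤
  · rw [hfin]
    exact le_top
  obtain ⟨hfd, hrank⟩ := finrank_lowSpan_le_eigenvalueCount hL hfin
  refine le_trans ?_ hrank
  have hSf := finite_of_pairwiseDisjoint_ball hρ0 hS.disjoint
  have := hSf.fintype
  rw [encard_eq_coe_toFinset_card, ENat.toENNReal_coe, toFinset_card]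
  rcases isEmpty_or_nonempty X with hX | hX
  · simp
  -- Scaled so that `√(4s) = 2^k ρ` is a dyadic multiple of the lattice scale and `2ωs = 4^k / 2`.
  set s := 4 ^ k * ρ ^ 2 / 4 with hs
  have hs0 : 0 < s := by positivity
  have h4s : 4 * s = (2 ^ k * ρ) ^ 2 := by
    rw [hs, mul_pow, ← pow_mul, mul_comm k 2, pow_mul]
    norm_num
    ring
  have h4s1 : 4 * s < 1 := by
    have : 4 * s = 4 ^ k * ρ ^ 2 := by rw [hs]; ring
    rw [this, ← hρω, mul_comm]
    gcongr
  have hsqrt4 : √(4 * s) = 2 ^ k * ρ := by rw [h4s, Real.sqrt_sq (by positivity)]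
  have hsqrt2 : ρ ≤ √(2 * s) := by
    refine Real.le_sqrt_of_sq_le ?_
    have : (4 : ℝ) ^ 1 ≤ 4 ^ k := pow_le_pow_right₀ (by norm_num) hk1
    rw [hs]
    nlinarith [sq_nonneg ρ]
  have hPpos : ∀ t x y, 0 < t → t < 1 → 0 ≤ P t x y := fun t x y ht ht1 =>
    le_trans (by positivity) (hG t x y ht ht1).1
  have hcomp : IsCompactOperator (T s) := by
    obtain ⟨m, hm0, hm⟩ := hA.exists_le_measureReal_ball (Real.sqrt_pos.mpr hs0)
    refine isCompactOperator_of_bounded_kernel (hP s hs0).1 (C := C₂ / m) (fun x y => ?_)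
      fun f => ((hP s hs0).2 f).2
    rw [abs_of_nonneg (hPpos s x y hs0 (by linarith))]
    exact (hG s x y hs0 (by linarith)).2.trans (gaussian_le hC₂ hc₂ hs0 hm0 (hm x) (hm y))
  have hB : ∀ z : S, MeasurableSet (ball (z : X) (ρ / 2)) := fun z => measurableSet_ball
  have hB0 : ∀ z : S, 0 < μ.real (ball (z : X) (ρ / 2)) := fun z => hA.pos z (by positivity)
  have horth : Orthonormal ℝ fun z : S => normalizedIndicator μ (hB z) :=
    orthonormal_normalizedIndicator hB hB0 fun z w hzw =>
      hS.disjoint z.2 w.2 fun h => hzw (Subtype.ext h)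
  have hlow : ∀ z : S, C₁ * Real.exp (-c₁) / G ≤
      ⟪T (4 * s) (normalizedIndicator μ (hB z)), normalizedIndicator μ (hB z)⟫_ℝ := by
    intro z
    -- `B(x, 2^k ρ)` lies in `B(z, 2^{k+2} · ρ/2)`, whence the exponent `k + 2` in `G`.
    have hV : ∀ x ∈ ball (z : X) (ρ / 2),
        μ.real (ball x √(4 * s)) ≤ G * μ.real (ball (z : X) (ρ / 2)) := by
      intro x hx
      refine le_trans (measureReal_mono ?_) (hdoub (k + 2) z (ρ / 2) (by positivity))
      refine ball_subset_ball' ?_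
      rw [hsqrt4, pow_add]
      rw [mem_ball] at hx
      have : (1 : ℝ) ≤ 2 ^ k := one_le_pow₀ one_le_two
      nlinarith
    -- Any upper bound serves here: only the lower half of the two-sided estimate is kept.
    obtain ⟨M, hM⟩ : ∃ M : ℝ, ∀ x ∈ ball (z : X) (ρ / 2), ∀ y ∈ ball (z : X) (ρ / 2),
        P (4 * s) x y ≤ M := by
      obtain ⟨m, hm0, hm⟩ := hA.exists_le_measureReal_ball
        (Real.sqrt_pos.mpr (by positivity : 0 < 4 * s))
      exact ⟨C₂ / m, fun x _ y _ => (hG _ x y (by positivity) h4s1).2.trans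
        (gaussian_le hC₂ hc₂ (by positivity) hm0 (hm x) (hm y))⟩
    have h := (inner_normalizedIndicator_mem_Icc (hP (4 * s) (by positivity)).2 (hB z) (hB0 z)
      (a := C₁ * Real.exp (-c₁) / (G * μ.real (ball (z : X) (ρ / 2)))) (b := M)
      fun x hx y hy => ⟨(le_gaussian hA hC₁ hc₁ (by positivity) ?_ (hV x hx) (hV y hy)).trans
        (hG _ x y (by positivity) h4s1).1, hM x hx y hy⟩).1
    · refine le_trans (le_of_eq ?_) h
      have := (hB0 z).ne'
      field_simp
    · rw [h4s]
      rw [mem_ball] at hx hy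
      have h1 := dist_triangle_right x y z
      have : (1 : ℝ) ≤ 2 ^ k := one_le_pow₀ one_le_two
      refine pow_le_pow_left₀ dist_nonneg ?_ 2
      nlinarith
  have hup : ∀ z : S,
      ⟪T (2 * s) (normalizedIndicator μ (hB z)), normalizedIndicator μ (hB z)⟫_ℝ ≤ C₂ := by
    intro z
    have hV : ∀ x ∈ ball (z : X) (ρ / 2),
        μ.real (ball (z : X) (ρ / 2)) ≤ μ.real (ball x √(2 * s)) := by
      intro x hx
      refine measureReal_mono (ball_subset_ball' ?_)
      rw [mem_ball, dist_comm] at hx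
      linarith
    have h := (inner_normalizedIndicator_mem_Icc (hP (2 * s) (by positivity)).2 (hB z) (hB0 z)
      (a := 0) (b := C₂ / μ.real (ball (z : X) (ρ / 2)))
      fun x hx y hy => ⟨hPpos _ x y (by positivity) (by linarith),
        (hG _ x y (by positivity) (by linarith)).2.trans
          (gaussian_le hC₂ hc₂ (by positivity) (hB0 z) (hV x hx) (hV y hy))⟩).2
    rwa [div_mul_cancel₀ _ (hB0 z).ne'] at h
  have hmain := hT.card_mul_le_finrank hL hL0 hs0 hcomp horth hlow hup Finset.univ (ω := ω)
  have hexp : 2 * ω * s = 4 ^ k / 2 := by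
    rw [hs]
    linear_combination (4 : ℝ) ^ k / 2 * hρω
  rw [hexp, Finset.card_univ] at hmain
  have hc : min (C₁ * Real.exp (-c₁) / 2 / G) (1 / 2) ≤
      C₁ * Real.exp (-c₁) / G - Real.exp (-(4 ^ k / 2)) * C₂ := by
    refine (min_le_left _ _).trans ?_
    have : C₁ * Real.exp (-c₁) / G = 2 * (C₁ * Real.exp (-c₁) / 2 / G) := by ring
    rw [this]
    linarith
  have hfinal : (Fintype.card S : ℝ) * min (C₁ * Real.exp (-c₁) / 2 / G) (1 / 2) ≤
      Module.finrank ℝ (lowSpan L ω) := le_trans (by gcongr) hmain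
  rw [← ENNReal.ofReal_natCast (Fintype.card S), ← ENNReal.ofReal_mul (by positivity), mul_comm,
    ← ENNReal.ofReal_natCast (Module.finrank ℝ (lowSpan L ω))]
  exact ENNReal.ofReal_le_ofReal hfinal

end LowerBound

end WeakWeyl

theorem theorem5p3 {X : Type*} [MetricSpace X] [CompactSpace X] [MeasurableSpace X] [BorelSpace X]
    (μ : Measure X) [IsFiniteMeasure μ] (L : Lp ℝ 2 μ →ₗ.[ℝ] Lp ℝ 2 μ)
    (hA : WeakWeyl.IsDoubling μ)
    (hB_selfAdjoint : IsSelfAdjoint L)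
    (hB_nonneg : ∀ f : L.domain, 0 ≤ inner ℝ (L f) (f : Lp ℝ 2 μ))
    (hB_algebra : WeakWeyl.SmoothDomainIsSubalgebra L)
    (hC : WeakWeyl.GradientBound L)
    (hD : WeakWeyl.LocalPoincare L)
    (hE : WeakWeyl.HasGaussianHeatKernel L) :
    (∃ N : ℕ, ∀ᶠ ρ : ℝ in 𝓝[>] 0, ∃ S : Set X, WeakWeyl.IsLattice ρ N S) ∧
    ∃ c γ : ℝ, 0 < c ∧ c < 1 ∧ 0 < γ ∧ γ < 1 ∧
      ∀ᶠ ω : ℝ in atTop, ∀ N : ℕ,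
        ENNReal.ofReal c *
            (⨆ (S : Set X) (_ : WeakWeyl.IsLattice (ω ^ (-(1 / 2) : ℝ)) N S), (S.encard : ℝ≥0∞)) ≤
          WeakWeyl.eigenvalueCount L ω ∧
        WeakWeyl.eigenvalueCount L ω ≤
          ⨅ (S : Set X) (_ : WeakWeyl.IsLattice (γ * ω ^ (-(1 / 2) : ℝ)) N S),
            (S.encard : ℝ≥0∞) := by
  have hL := WeakWeyl.symmetric_of_isSelfAdjoint hB_selfAdjoint
  obtain ⟨N, hN⟩ := hA.exists_isLattice
  obtain ⟨c, hc0, hc1, hlow⟩ :=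
    WeakWeyl.exists_mul_encard_le_eigenvalueCount hA hL hB_nonneg hE
  obtain ⟨γ, hγ0, hγ1, hup⟩ := WeakWeyl.exists_eigenvalueCount_le hA hL hB_algebra hC hD
  refine ⟨⟨N, ?_⟩, c, γ, hc0, hc1, hγ0, hγ1, ?_⟩
  · filter_upwards [self_mem_nhdsWithin] with ρ hρ using hN ρ hρ
  · filter_upwards [hlow, hup] with ω h1 h2 N
    refine ⟨?_, le_iInf₂ fun S hS => h2 N S hS⟩
    simp_rw [ENNReal.mul_iSup]
    exact iSup₂_le fun S hS => h1 N S hS
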